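/- **Setting.** An instance $I$ of the robust shortest path problem consists of a finite simple undirected graph $G$ on $n$ vertices, an origin $s$ and a destination $t$ that are joined by a path in $G$, and for every vertex $i$ a finite nonempty set $\mathcal U_i$ of possible positions in a metric space $(\mathcal M,d)$; the distances between all pairs of points of $\bigcup_i\mathcal U_i$ are given explicitly in the input. Write $\mathcal U=\prod_i\mathcal U_i$ and $\sigma=\max_i|\mathcal U_i|$. The cost of a simple $s$–$t$ path $P$ is $$c(P)=\max_{u\in\mathcal U}\ \sum_{\{i,j\}\in E[P]} d(u_i,u_j),$$ and $\mathrm{opt}(I)$ is the minimum of $c(P)$ over all simple $s$–$t$ paths $P$. Time is counted as the number of elementary operations of a random access machine. The machine has registers and arrays for natural numbers ("words"), with arithmetic, comparison and indirect addressing, and registers and arrays for real numbers, which can only be copied, added, subtracted and compared. **Theorem.** For fixed $\sigma$, the robust shortest path problem admits an FPTAS. More precisely, there is an algorithm (one program) such that for every $\sigma$ there is a constant $C_\sigma$ with the following property. For every instance $I$ with $\max_i|\mathcal U_i|=\sigma$ and every real $\varepsilon>0$, the algorithm on input $(I,\varepsilon)$ outputs a simple $s$–$t$ path $P$ with $c(P)\le(1+\varepsilon)\,\mathrm{opt}(I)$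 after at most $$C_\sigma\, n^3\sigma^2\,\max\{1,\,n^2/\varepsilon\}^{\sigma}$$ steps, and all words that occur in the computation have size at most this number. In particular, for $\varepsilon\le n^2$ the running time is $O\!\left(n^3\sigma^2\left(\frac{n^2}{\varepsilon}\right)^{\sigma}\right)$. -/

import Mathlib

/-! # The robust shortest path problem -/

namespace RobustSP

/-- An instance of the robust shortest path problem in a metric space `M`: a simple undirected
graph on `n` vertices, an origin `s` and a destination `t`, and for each vertex `i` a finite
nonempty uncertainty set `{loc i 0, …, loc i (size i - 1)}` of `size i` distinct points of `M`. -/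
structure Instance (M : Type*) [MetricSpace M] where
  n : ℕ
  G : SimpleGraph (Fin n)
  s : Fin n
  t : Fin n
  size : Fin n → ℕ
  size_pos : ∀ i, 0 < size i
  loc : (i : Fin n) → Fin (size i) → M
  loc_injective : ∀ i, Function.Injective (loc i)

namespace Instance

variable {M : Type*} [MetricSpace M] (I : Instance M)

/-- The largest cardinality of an uncertainty set. -/
def sigma : ℕ := Finset.univ.sup I.size

/-- An element `u` of the product of all the uncertainty sets; the position of the vertex `i`
is `I.loc i (u i)`. -/
abbrev Scenario : Type := (i : Fin I.n) → Fin (I.size i)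

instance : Nonempty I.Scenario := ⟨fun i => ⟨0, I.size_pos i⟩⟩

/-- The weight `d(u_i, u_j)` of the edge `{i, j}` in the scenario `u`. -/
noncomputable def edgeCost (u : I.Scenario) : Sym2 (Fin I.n) → ℝ :=
  Sym2.lift ⟨fun i j => dist (I.loc i (u i)) (I.loc j (u j)), fun _ _ => dist_comm _ _⟩

/-- The cost `c(u, P)`: the sum of the weights of the edges of `P` in the scenario `u`. -/
noncomputable def costIn (u : I.Scenario) {i j : Fin I.n} (P : I.G.Walk i j) : ℝ :=
  (P.edges.map (I.edgeCost u)).sum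

/-- The robust cost `c(P)`, the maximum of `c(u, P)` over all scenarios `u`. -/
noncomputable def cost {i j : Fin I.n} (P : I.G.Walk i j) : ℝ :=
  Finset.univ.sup' Finset.univ_nonempty fun u : I.Scenario => I.costIn u P

/-- `P` is a (simple) `s`-`t` path whose robust cost is at most `α` times that of every
`s`-`t` path. -/
def IsApprox (α : ℝ) (P : I.G.Walk I.s I.t) : Prop :=
  P.IsPath ∧ ∀ Q : I.G.Walk I.s I.t, Q.IsPath → I.cost P ≤ α * I.cost Q

end Instance

/-! # A random access machine

Programs work on finitely many word registers, word arrays, real registers and real arrays. Words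
are natural numbers of size at most `W`, where `W` is a parameter of the machine; a program that
produces a larger word has no execution. Real numbers can only be copied, added, subtracted and
compared; there is no multiplication, no rounding and no conversion of reals into words. Every
operation costs one time unit. -/

/-- The contents of the memory: registers and arrays, the latter given as name, index, content. -/
structure Store where
  word : ℕ → ℕ
  wordArr : ℕ → ℕ → ℕ
  real : ℕ → ℝ
  realArr : ℕ → ℕ → ℝ

/-- Expressions with word values. In `arr a e`, the array name `a` is fixed in the program and
the index `e` is computed. -/
inductive WExpr : Type
  | const (c : ℕ)
  | reg (x : ℕ)
  | arr (a : ℕ) (e : WExpr)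
  | add (e f : WExpr)
  | sub (e f : WExpr)
  | mul (e f : WExpr)
  | div (e f : WExpr)
  | mod (e f : WExpr)

/-- The value of a word expression; subtraction is truncated. -/
def WExpr.eval (m : Store) : WExpr → ℕ
  | const c => c
  | reg x => m.word x
  | arr a e => m.wordArr a (e.eval m)
  | add e f => e.eval m + f.eval m
  | sub e f => e.eval m - f.eval m
  | mul e f => e.eval m * f.eval m
  | div e f => e.eval m / f.eval m
  | mod e f => e.eval m % f.eval m

/-- All the words produced in the evaluation of an expression are at most `W`. -/
def WExpr.Fits (W : ℕ) (m : Store) : WExpr → Prop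
  | const c => c ≤ W
  | reg x => m.word x ≤ W
  | arr a e => e.Fits W m ∧ m.wordArr a (e.eval m) ≤ W
  | add e f => e.Fits W m ∧ f.Fits W m ∧ e.eval m + f.eval m ≤ W
  | sub e f => e.Fits W m ∧ f.Fits W m
  | mul e f => e.Fits W m ∧ f.Fits W m ∧ e.eval m * f.eval m ≤ W
  | div e f => e.Fits W m ∧ f.Fits W m
  | mod e f => e.Fits W m ∧ f.Fits W m

/-- The number of operations in a word expression. -/
def WExpr.time : WExpr → ℕ
  | const _ => 1
  | reg _ => 1
  | arr _ e => e.time + 1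
  | add e f => e.time + f.time + 1
  | sub e f => e.time + f.time + 1
  | mul e f => e.time + f.time + 1
  | div e f => e.time + f.time + 1
  | mod e f => e.time + f.time + 1

/-- Expressions with real values. -/
inductive RExpr : Type
  | zero
  | one
  | reg (x : ℕ)
  | arr (a : ℕ) (e : WExpr)
  | add (e f : RExpr)
  | sub (e f : RExpr)

noncomputable def RExpr.eval (m : Store) : RExpr → ℝ
  | zero => 0
  | one => 1
  | reg x => m.real x
  | arr a e => m.realArr a (e.eval m)
  | add e f => e.eval m + f.eval m
  | sub e f => e.eval m - f.eval m

/-- All the words (array indices) produced in the evaluation are at most `W`. -/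
def RExpr.Fits (W : ℕ) (m : Store) : RExpr → Prop
  | zero => True
  | one => True
  | reg _ => True
  | arr _ e => e.Fits W m
  | add e f => e.Fits W m ∧ f.Fits W m
  | sub e f => e.Fits W m ∧ f.Fits W m

def RExpr.time : RExpr → ℕ
  | zero => 1
  | one => 1
  | reg _ => 1
  | arr _ e => e.time + 1
  | add e f => e.time + f.time + 1
  | sub e f => e.time + f.time + 1

/-- Boolean tests: comparisons of words or of reals, and their Boolean combinations. -/
inductive Test : Type
  | le (e f : WExpr)
  | rle (e f : RExpr)
  | not (b : Test)
  | and (b c : Test)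

def Test.Holds (m : Store) : Test → Prop
  | le e f => e.eval m ≤ f.eval m
  | rle e f => e.eval m ≤ f.eval m
  | not b => ¬ b.Holds m
  | and b c => b.Holds m ∧ c.Holds m

def Test.Fits (W : ℕ) (m : Store) : Test → Prop
  | le e f => e.Fits W m ∧ f.Fits W m
  | rle e f => e.Fits W m ∧ f.Fits W m
  | not b => b.Fits W m
  | and b c => b.Fits W m ∧ c.Fits W m

def Test.time : Test → ℕ
  | le e f => e.time + f.time + 1
  | rle e f => e.time + f.time + 1
  | not b => b.time + 1
  | and b c => b.time + c.time + 1

/-- Programs. -/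
inductive Program : Type
  | skip
  | setWord (x : ℕ) (e : WExpr)
  | setWordArr (a : ℕ) (i e : WExpr)
  | setReal (x : ℕ) (e : RExpr)
  | setRealArr (a : ℕ) (i : WExpr) (e : RExpr)
  | seq (p q : Program)
  | ite (b : Test) (p q : Program)
  | loop (b : Test) (p : Program)

/-- `Exec W p m T m'`: started with memory `m`, the program `p` terminates after exactly `T` time
units with memory `m'`, on a machine with words of size at most `W`. -/
inductive Exec (W : ℕ) : Program → Store → ℕ → Store → Prop
  | skip (m : Store) : Exec W .skip m 1 m
  | setWord (m : Store) (x : ℕ) (e : WExpr) (he : e.Fits W m) :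
      Exec W (.setWord x e) m (e.time + 1)
        { m with word := Function.update m.word x (e.eval m) }
  | setWordArr (m : Store) (a : ℕ) (i e : WExpr) (hi : i.Fits W m) (he : e.Fits W m) :
      Exec W (.setWordArr a i e) m (i.time + e.time + 1)
        { m with wordArr := Function.update m.wordArr a
                   (Function.update (m.wordArr a) (i.eval m) (e.eval m)) }
  | setReal (m : Store) (x : ℕ) (e : RExpr) (he : e.Fits W m) :
      Exec W (.setReal x e) m (e.time + 1)
        { m with real := Function.update m.real x (e.eval m) }
  | setRealArr (m : Store) (a : ℕ) (i : WExpr) (e : RExpr) (hi : i.Fits W m)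
      (he : e.Fits W m) :
      Exec W (.setRealArr a i e) m (i.time + e.time + 1)
        { m with realArr := Function.update m.realArr a
                   (Function.update (m.realArr a) (i.eval m) (e.eval m)) }
  | seq (p q : Program) (m₀ m₁ m₂ : Store) (T₁ T₂ : ℕ)
      (h₁ : Exec W p m₀ T₁ m₁) (h₂ : Exec W q m₁ T₂ m₂) :
      Exec W (.seq p q) m₀ (T₁ + T₂) m₂
  | iteTrue (b : Test) (p q : Program) (m m' : Store) (T : ℕ) (hf : b.Fits W m)
      (hb : b.Holds m) (h : Exec W p m T m') :
      Exec W (.ite b p q) m (b.time + T + 1) m'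
  | iteFalse (b : Test) (p q : Program) (m m' : Store) (T : ℕ) (hf : b.Fits W m)
      (hb : ¬ b.Holds m) (h : Exec W q m T m') :
      Exec W (.ite b p q) m (b.time + T + 1) m'
  | loopTrue (b : Test) (p : Program) (m₀ m₁ m₂ : Store) (T₁ T₂ : ℕ) (hf : b.Fits W m₀)
      (hb : b.Holds m₀) (h₁ : Exec W p m₀ T₁ m₁) (h₂ : Exec W (.loop b p) m₁ T₂ m₂) :
      Exec W (.loop b p) m₀ (b.time + T₁ + T₂ + 1) m₂
  | loopFalse (b : Test) (p : Program) (m : Store) (hf : b.Fits W m) (hb : ¬ b.Holds m) :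
      Exec W (.loop b p) m (b.time + 1) m

/-! # Input and output -/

namespace Instance

variable {M : Type*} [MetricSpace M] (I : Instance M)

/-- The point listed at place `p = i * σ + k`, which is `loc i k` (if `k < size i`). -/
def pointAt (p : ℕ) : Option M :=
  if hi : p / I.sigma < I.n then
    if hk : p % I.sigma < I.size ⟨p / I.sigma, hi⟩ then
      some (I.loc ⟨p / I.sigma, hi⟩ ⟨p % I.sigma, hk⟩)
    else none
  else none

/-- The matrix with the distances of all pairs of points, stored row by row: the distance of
`loc i k` and `loc j l` is at place `(i * σ + k) * (n * σ) + (j * σ + l)`. -/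
noncomputable def distArr (p : ℕ) : ℝ :=
  match I.pointAt (p / (I.n * I.sigma)), I.pointAt (p % (I.n * I.sigma)) with
  | some x, some y => dist x y
  | _, _ => 0

open Classical in
/-- The adjacency matrix, stored row by row. -/
noncomputable def adjArr (p : ℕ) : ℕ :=
  if ∃ i j : Fin I.n, p = i * I.n + j ∧ I.G.Adj i j then 1 else 0

/-- The list of the sizes of the uncertainty sets. -/
def sizeArr (i : ℕ) : ℕ :=
  if hi : i < I.n then I.size ⟨i, hi⟩ else 0

/-- The initial memory for the instance `I` and the accuracy `ε`: the word registers 0, 1, 2, 3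
contain `n`, `s`, `t`, `σ`, the word arrays 0 and 1 the adjacency matrix and the sizes of the
uncertainty sets, the real register 0 contains `ε` and the real array 0 the distance matrix.
Everything else is 0. -/
noncomputable def input (ε : ℝ) : Store where
  word x := match x with
    | 0 => I.n
    | 1 => I.s
    | 2 => I.t
    | 3 => I.sigma
    | _ => 0
  wordArr a := match a with
    | 0 => I.adjArr
    | 1 => I.sizeArr
    | _ => fun _ => 0
  real x := match x with
    | 0 => ε
    | _ => 0
  realArr a := match a with
    | 0 => I.distArr
    | _ => fun _ => 0

/-- The memory `m` contains `P` as output: the number of its edges in the word register 0 and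
its successive vertices in the word array 0. -/
def IsOutput (m : Store) (P : I.G.Walk I.s I.t) : Prop :=
  m.word 0 = P.length ∧ ∀ k ≤ P.length, m.wordArr 0 k = P.getVert k

/-- The quantity `n³ σ² (n² / ε)^σ`, with `n² / ε` replaced by `1` where `ε > n²`. -/
noncomputable def bound (ε : ℝ) : ℝ :=
  (I.n : ℝ) ^ 3 * (I.sigma : ℝ) ^ 2 * (max 1 ((I.n : ℝ) ^ 2 / ε)) ^ I.sigma

end Instance

end RobustSP

namespace RobustSP

/-! # A calculus of running times -/

/-! Give each edge the largest distance between points of its two ends as its weight. A path never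
costs more than its total weight. Conversely each edge weight is attained in some scenario, so the
weight of a path is at most its length times its robust cost. A shortest path for these weights
(Bellman–Ford) therefore has a length `D` with opt ≤ `D` ≤ `n` · opt (`Instance.estimate`).

Take the least positive `N` with `n²` ≤ `N ε`, round each distance down to a multiple of `D / N`,
and cap the multiple at `N + 1`. A path of cost at most `D` has rounded cost at most `N`. Rounding
loses at most `D / N` per edge, hence at most `n D / N ≤ ε` · opt on a path
(`walkSum_le_mul_of_rounded`).

The rounded problem is solved by dynamic programming from `t`. A state is a vertex `v` with a vector
in `{0, …, N}^σ`, whose `l`-th entry stands for the largest rounded cost of a walk from `v` to `t`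
when `v` sits at its `l`-th point. An edge extends a state by a max-plus step costing `σ²`. There
are `n (N + 1)^σ` states with at most `n` successors each, and breadth-first search finds all those
reachable from `t` with the zero vector. For a simple path the vertices move independently, so the
recursion is exact (`exists_state_of_isPath`). A state may come from a walk that repeats vertices,
but in a fixed scenario the values are monotone along the walk, so cutting out closed pieces does no
harm: some simple path costs at most what the state says (`exists_isPath_of_steps`). The best state
at `s` thus yields the approximation (`Instance.isApprox_of_best`).

The remainder verifies a program. `Runs` is a Hoare triple with a time bound; loops are handled by
`Runs.loop` and `Runs.forLoop`, loop-free code by `Runs.of_wp`. Each stage takes `O(n³ σ² (N +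
1)^σ)` steps, and `N + 1 ≤ 3 max(1, n² / ε)`. -/

/-- Whether the program contains an assignment to the word register `y`. -/
def Program.writesWord : Program → ℕ → Bool
  | skip, _ => false
  | setWord x _, y => x == y
  | setWordArr _ _ _, _ => false
  | setReal _ _, _ => false
  | setRealArr _ _ _, _ => false
  | seq p q, y => p.writesWord y || q.writesWord y
  | ite _ p q, y => p.writesWord y || q.writesWord y
  | loop _ p, y => p.writesWord y

/-- Whether the program contains an assignment to the word array `y`. -/
def Program.writesWordArr : Program → ℕ → Bool
  | skip, _ => false
  | setWord _ _, _ => false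
  | setWordArr a _ _, y => a == y
  | setReal _ _, _ => false
  | setRealArr _ _ _, _ => false
  | seq p q, y => p.writesWordArr y || q.writesWordArr y
  | ite _ p q, y => p.writesWordArr y || q.writesWordArr y
  | loop _ p, y => p.writesWordArr y

/-- Whether the program contains an assignment to the real register `y`. -/
def Program.writesReal : Program → ℕ → Bool
  | skip, _ => false
  | setWord _ _, _ => false
  | setWordArr _ _ _, _ => false
  | setReal x _, y => x == y
  | setRealArr _ _ _, _ => false
  | seq p q, y => p.writesReal y || q.writesReal y
  | ite _ p q, y => p.writesReal y || q.writesReal y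
  | loop _ p, y => p.writesReal y

/-- Whether the program contains an assignment to the real array `y`. -/
def Program.writesRealArr : Program → ℕ → Bool
  | skip, _ => false
  | setWord _ _, _ => false
  | setWordArr _ _ _, _ => false
  | setReal _ _, _ => false
  | setRealArr a _ _, y => a == y
  | seq p q, y => p.writesRealArr y || q.writesRealArr y
  | ite _ p q, y => p.writesRealArr y || q.writesRealArr y
  | loop _ p, y => p.writesRealArr y

/-- The memories `m` and `m'` differ only in places to which `p` assigns. -/
structure Frame (p : Program) (m m' : Store) : Prop where
  word : ∀ y, p.writesWord y = false → m'.word y = m.word y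
  wordArr : ∀ y, p.writesWordArr y = false → m'.wordArr y = m.wordArr y
  real : ∀ y, p.writesReal y = false → m'.real y = m.real y
  realArr : ∀ y, p.writesRealArr y = false → m'.realArr y = m.realArr y

theorem Frame.refl (p : Program) (m : Store) : Frame p m m :=
  ⟨fun _ _ => rfl, fun _ _ => rfl, fun _ _ => rfl, fun _ _ => rfl⟩

theorem Frame.trans {p : Program} {m₁ m₂ m₃ : Store} (h : Frame p m₁ m₂) (h' : Frame p m₂ m₃) :
    Frame p m₁ m₃ :=
  ⟨fun y hy => (h'.word y hy).trans (h.word y hy),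
    fun y hy => (h'.wordArr y hy).trans (h.wordArr y hy),
    fun y hy => (h'.real y hy).trans (h.real y hy),
    fun y hy => (h'.realArr y hy).trans (h.realArr y hy)⟩

theorem Frame.mono {p q : Program} {m m' : Store} (h : Frame p m m')
    (h₁ : ∀ y, q.writesWord y = false → p.writesWord y = false)
    (h₂ : ∀ y, q.writesWordArr y = false → p.writesWordArr y = false)
    (h₃ : ∀ y, q.writesReal y = false → p.writesReal y = false)
    (h₄ : ∀ y, q.writesRealArr y = false → p.writesRealArr y = false) : Frame q m m' :=
  ⟨fun y hy => h.word y (h₁ y hy), fun y hy => h.wordArr y (h₂ y hy),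
    fun y hy => h.real y (h₃ y hy), fun y hy => h.realArr y (h₄ y hy)⟩

theorem Frame.seq_left {p q : Program} {m m' : Store} (h : Frame p m m') :
    Frame (.seq p q) m m' := by
  apply h.mono <;> intro y hy <;>
    simp_all [Program.writesWord, Program.writesWordArr, Program.writesReal,
      Program.writesRealArr]

theorem Frame.seq_right {p q : Program} {m m' : Store} (h : Frame q m m') :
    Frame (.seq p q) m m' := by
  apply h.mono <;> intro y hy <;>
    simp_all [Program.writesWord, Program.writesWordArr, Program.writesReal,
      Program.writesRealArr]

theorem Frame.loop {b : Test} {p : Program} {m m' : Store} (h : Frame p m m') :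
    Frame (.loop b p) m m' :=
  h.mono (fun _ hy => hy) (fun _ hy => hy) (fun _ hy => hy) (fun _ hy => hy)

/-- This supplies all later facts that a register or array survives a stage. The `writes…` functions
are Boolean and compute, so the side condition is closed by `rfl`. -/
theorem Exec.frame {W : ℕ} {p : Program} {m m' : Store} {T : ℕ} (h : Exec W p m T m') :
    Frame p m m' := by
  induction h with
  | skip m => exact Frame.refl _ _
  | setWord m x e he =>
    refine ⟨fun y hy => ?_, fun _ _ => rfl, fun _ _ => rfl, fun _ _ => rfl⟩
    have : y ≠ x := by rintro rfl; simp [Program.writesWord] at hy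
    simp [this]
  | setWordArr m x i e hi he =>
    refine ⟨fun _ _ => rfl, fun y hy => ?_, fun _ _ => rfl, fun _ _ => rfl⟩
    have : y ≠ x := by rintro rfl; simp [Program.writesWordArr] at hy
    simp [this]
  | setReal m x e he =>
    refine ⟨fun _ _ => rfl, fun _ _ => rfl, fun y hy => ?_, fun _ _ => rfl⟩
    have : y ≠ x := by rintro rfl; simp [Program.writesReal] at hy
    simp [this]
  | setRealArr m x i e hi he =>
    refine ⟨fun _ _ => rfl, fun _ _ => rfl, fun _ _ => rfl, fun y hy => ?_⟩
    have : y ≠ x := by rintro rfl; simp [Program.writesRealArr] at hy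
    simp [this]
  | seq p q m₀ m₁ m₂ T₁ T₂ h₁ h₂ ih₁ ih₂ => exact ih₁.seq_left.trans ih₂.seq_right
  | iteTrue b p q m m' T hf hb h ih =>
    exact (ih.seq_left (q := q)).mono (fun _ hy => hy) (fun _ hy => hy) (fun _ hy => hy)
      (fun _ hy => hy)
  | iteFalse b p q m m' T hf hb h ih =>
    exact (ih.seq_right (p := p)).mono (fun _ hy => hy) (fun _ hy => hy) (fun _ hy => hy)
      (fun _ hy => hy)
  | loopTrue b p m₀ m₁ m₂ T₁ T₂ hf hb h₁ h₂ ih₁ ih₂ => exact ih₁.loop.trans ih₂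
  | loopFalse b p m hf hb => exact Frame.refl _ _

/-- Started with memory `m`, the program `p` terminates within `t` time units with a memory
satisfying `Q`. -/
def Runs (W : ℕ) (p : Program) (m : Store) (t : ℕ) (Q : Store → Prop) : Prop :=
  ∃ T m', Exec W p m T m' ∧ T ≤ t ∧ Q m'

namespace Runs

variable {W : ℕ} {p q : Program} {m : Store} {t t₁ t₂ : ℕ} {Q R : Store → Prop}

theorem mono (h : Runs W p m t₁ R) (ht : t₁ ≤ t₂) (hQ : ∀ m', Frame p m m' → R m' → Q m') :
    Runs W p m t₂ Q := by
  obtain ⟨T, m', he, hT, hR⟩ := h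
  exact ⟨T, m', he, hT.trans ht, hQ m' he.frame hR⟩

theorem seq (h₁ : Runs W p m t₁ R)
    (h₂ : ∀ m', Frame p m m' → R m' → Runs W q m' t₂ Q) : Runs W (.seq p q) m (t₁ + t₂) Q := by
  obtain ⟨T₁, m₁, he₁, hT₁, hR⟩ := h₁
  obtain ⟨T₂, m₂, he₂, hT₂, hQ⟩ := h₂ m₁ he₁.frame hR
  exact ⟨_, _, .seq _ _ _ _ _ _ _ he₁ he₂, by omega, hQ⟩

theorem ite {b : Test} (hf : b.Fits W m) (h₁ : b.Holds m → Runs W p m t Q)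
    (h₂ : ¬ b.Holds m → Runs W q m t Q) : Runs W (.ite b p q) m (b.time + t + 1) Q := by
  by_cases hb : b.Holds m
  · obtain ⟨T, m', he, hT, hQ⟩ := h₁ hb
    exact ⟨_, _, .iteTrue _ _ _ _ _ _ hf hb he, by omega, hQ⟩
  · obtain ⟨T, m', he, hT, hQ⟩ := h₂ hb
    exact ⟨_, _, .iteFalse _ _ _ _ _ _ hf hb he, by omega, hQ⟩

/-- A loop with at most `K` iterations. -/
theorem loop {b : Test} (Inv : ℕ → Store → Prop) (K c : ℕ) (h0 : Inv 0 m)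
    (hf : ∀ k m', k ≤ K → Frame p m m' → Inv k m' → b.Fits W m')
    (hs : ∀ k m', k ≤ K → Frame p m m' → Inv k m' → b.Holds m' →
      k < K ∧ Runs W p m' c (Inv (k + 1))) :
    Runs W (.loop b p) m (K * (b.time + c + 1) + (b.time + 1))
      (fun m' => ∃ k ≤ K, Inv k m' ∧ ¬ b.Holds m') := by
  suffices H : ∀ r k m', k + r = K → Frame p m m' → Inv k m' →
      Runs W (.loop b p) m' (r * (b.time + c + 1) + (b.time + 1))
        (fun m' => ∃ k ≤ K, Inv k m' ∧ ¬ b.Holds m') from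
    H K 0 m (by omega) (Frame.refl _ _) h0
  intro r
  induction r with
  | zero =>
    intro k m' hk hF hI
    have hb : ¬ b.Holds m' := fun hb => by
      have := (hs k m' (by omega) hF hI hb).1
      omega
    exact ⟨_, _, .loopFalse _ _ _ (hf k m' (by omega) hF hI) hb, by simp,
      k, by omega, hI, hb⟩
  | succ r ih =>
    intro k m' hk hF hI
    by_cases hb : b.Holds m'
    · obtain ⟨-, T₁, m₁, he₁, hT₁, hI₁⟩ := hs k m' (by omega) hF hI hb
      obtain ⟨T₂, m₂, he₂, hT₂, hQ⟩ :=
        ih (k + 1) m₁ (by omega) (hF.trans he₁.frame) hI₁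
      refine ⟨_, _, .loopTrue _ _ _ _ _ _ _ (hf k m' (by omega) hF hI) hb he₁ he₂, ?_, hQ⟩
      rw [add_mul]
      omega
    · exact ⟨_, _, .loopFalse _ _ _ (hf k m' (by omega) hF hI) hb, by simp,
        k, by omega, hI, hb⟩

end Runs

/-- `for x = 0, …, e - 1 do p`, where `p` must not change `x` and `e`. -/
def Program.forLoop (x : ℕ) (e : WExpr) (p : Program) : Program :=
  .seq (.setWord x (.const 0))
    (.loop (.not (.le e (.reg x))) (.seq p (.setWord x (.add (.reg x) (.const 1)))))

/-- The rule increments the counter itself, so the invariant has to be blind to `x` (`hloc`). The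
bound is re-evaluated at every test and must be `K` in each memory that the loop can reach (`he`).
-/
theorem Runs.forLoop {W x : ℕ} {e : WExpr} {p : Program} {m : Store}
    (Inv : ℕ → Store → Prop) (K c : ℕ) (hx : p.writesWord x = false) (hK : K ≤ W)
    (hloc : ∀ k m v, Inv k m → Inv k { m with word := Function.update m.word x v })
    (he : ∀ m', Frame (.forLoop x e p) m m' → e.Fits W m' ∧ e.eval m' = K)
    (h0 : Inv 0 m)
    (hs : ∀ k m', k < K → Frame (.forLoop x e p) m m' → m'.word x = k → Inv k m' →
      Runs W p m' c (Inv (k + 1))) :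
    Runs W (.forLoop x e p) m (K * (e.time + c + 8) + (e.time + 6)) (Inv K) := by
  have hinit : Runs W (.setWord x (.const 0)) m 2
      (fun m' => m'.word x = 0 ∧ Inv 0 m') :=
    ⟨_, _, .setWord _ _ _ (Nat.zero_le _), le_rfl, by simp [WExpr.eval], hloc _ _ _ h0⟩
  -- A test costs `e.time + 3`, the body with its increment `c + 4`, and the loop rule adds 1 per
  -- iteration.
  refine (Runs.seq hinit (t₂ := K * ((e.time + 3) + (c + 4) + 1) + (e.time + 4))
    fun m₁ hF₁ ⟨hx₁, hI₁⟩ => ?_).mono (by ring_nf; omega) (fun _ _ h => h)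
  have hF₁' : Frame (.forLoop x e p) m m₁ := hF₁.seq_left
  refine (Runs.loop (fun k m' => m'.word x = k ∧ Inv k m' ∧ k ≤ K) K (c + 4)
    ⟨hx₁, hI₁, Nat.zero_le _⟩ ?_ ?_).mono le_rfl ?_
  · rintro k m' hk hF ⟨hxk, hI, -⟩
    have hF' : Frame (.forLoop x e p) m m' := hF₁'.trans hF.loop.seq_right
    exact ⟨(he m' hF').1, by simp only [WExpr.Fits, hxk]; omega⟩
  · rintro k m' hk hF ⟨hxk, hI, -⟩ hb
    have hF' : Frame (.forLoop x e p) m m' := hF₁'.trans hF.loop.seq_right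
    have hkK : k < K := by
      simpa [Test.Holds, (he m' hF').2, WExpr.eval, hxk] using hb
    refine ⟨hkK, Runs.seq (hs k m' hkK hF' hxk hI) (t₂ := 4) fun m₂ hF₂ hI₂ => ?_⟩
    have hx₂ : m₂.word x = k := (hF₂.word x hx).trans hxk
    refine ⟨_, _, .setWord _ _ _ ?_, le_rfl, ?_, hloc _ _ _ hI₂, hkK⟩
    · simp only [WExpr.Fits, WExpr.eval, hx₂]
      omega
    · simp [WExpr.eval, hx₂]
  · rintro m' hF ⟨k, hk, ⟨hxk, hI, -⟩, hb⟩
    have hF' : Frame (.forLoop x e p) m m' := hF₁'.trans hF.seq_right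
    have : K ≤ k := by
      simpa [Test.Holds, (he m' hF').2, WExpr.eval, hxk] using hb
    obtain rfl : k = K := le_antisymm hk this
    exact hI

/-- The weakest precondition of a program without loops. -/
def Program.wp (W : ℕ) : Program → (Store → Prop) → Store → Prop
  | skip, Q, m => Q m
  | setWord x e, Q, m => e.Fits W m ∧
      Q { m with word := Function.update m.word x (e.eval m) }
  | setWordArr a i e, Q, m => i.Fits W m ∧ e.Fits W m ∧
      Q { m with wordArr := Function.update m.wordArr a
                   (Function.update (m.wordArr a) (i.eval m) (e.eval m)) }
  | setReal x e, Q, m => e.Fits W m ∧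
      Q { m with real := Function.update m.real x (e.eval m) }
  | setRealArr a i e, Q, m => i.Fits W m ∧ e.Fits W m ∧
      Q { m with realArr := Function.update m.realArr a
                   (Function.update (m.realArr a) (i.eval m) (e.eval m)) }
  | seq p q, Q, m => p.wp W (q.wp W Q) m
  | ite b p q, Q, m => b.Fits W m ∧ (b.Holds m → p.wp W Q m) ∧ (¬ b.Holds m → q.wp W Q m)
  | loop _ _, _, _ => False

/-- The worst-case running time of a program without loops. -/
def Program.straightTime : Program → ℕ
  | skip => 1
  | setWord _ e => e.time + 1
  | setWordArr _ i e => i.time + e.time + 1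
  | setReal _ e => e.time + 1
  | setRealArr _ i e => i.time + e.time + 1
  | seq p q => p.straightTime + q.straightTime
  | ite b p q => b.time + max p.straightTime q.straightTime + 1
  | loop _ _ => 0

/-- A loop has precondition `False`, so only loop-free code qualifies. For such code `simp` unfolds
the precondition and `decide` bounds the time. -/
theorem Runs.of_wp {W : ℕ} {p : Program} {m : Store} {t : ℕ} {Q : Store → Prop}
    (h : p.wp W Q m) (ht : p.straightTime ≤ t) : Runs W p m t Q := by
  suffices H : Runs W p m p.straightTime Q from H.mono ht (fun _ _ h => h)
  clear ht t
  induction p generalizing m Q with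
  | skip => exact ⟨_, _, .skip _, le_rfl, h⟩
  | setWord x e => exact ⟨_, _, .setWord _ _ _ h.1, le_rfl, h.2⟩
  | setWordArr a i e => exact ⟨_, _, .setWordArr _ _ _ _ h.1 h.2.1, le_rfl, h.2.2⟩
  | setReal x e => exact ⟨_, _, .setReal _ _ _ h.1, le_rfl, h.2⟩
  | setRealArr a i e => exact ⟨_, _, .setRealArr _ _ _ _ h.1 h.2.1, le_rfl, h.2.2⟩
  | seq p q ihp ihq => exact (ihp h).seq fun m' _ h' => ihq h'
  | ite b p q ihp ihq =>
    exact Runs.ite h.1 (fun hb => (ihp (h.2.1 hb)).mono (le_max_left _ _) fun _ _ h => h)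
      (fun hb => (ihq (h.2.2 hb)).mono (le_max_right _ _) fun _ _ h => h)
  | loop b p ih => exact h.elim

/-! # Costs of walks -/

/-- The place of the pair of the `k`-th point of the vertex `i` and the `l`-th point of the
vertex `j` in the distance matrix. -/
def place (n σ i k j l : ℕ) : ℕ := (i * σ + k) * (n * σ) + (j * σ + l)

theorem mul_add_lt_mul {a b A B : ℕ} (ha : a < A) (hb : b < B) : a * B + b < A * B := by
  calc a * B + b < a * B + B := by omega
    _ = (a + 1) * B := by ring
    _ ≤ A * B := Nat.mul_le_mul_right _ ha

theorem place_lt {n σ i k j l : ℕ} (hi : i < n) (hk : k < σ) (hj : j < n) (hl : l < σ) :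
    place n σ i k j l < n * σ * (n * σ) :=
  mul_add_lt_mul (mul_add_lt_mul hi hk) (mul_add_lt_mul hj hl)

section WalkSum

variable {n : ℕ} {G : SimpleGraph (Fin n)}

/-- The sum of the entries of the matrix `a` along a walk in the scenario `u`. -/
def walkSum {α : Type*} [AddCommMonoid α] (σ : ℕ) (a : ℕ → α) (u : ℕ → ℕ) :
    ∀ {v w : Fin n}, G.Walk v w → α
  | _, _, .nil => 0
  | v, _, .cons (v := v') _ p => a (place n σ v' (u v') v (u v)) + walkSum σ a u p

@[simp]
theorem walkSum_nil {α : Type*} [AddCommMonoid α] (σ : ℕ) (a : ℕ → α) (u : ℕ → ℕ) (v : Fin n) :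
    walkSum σ a u (.nil : G.Walk v v) = 0 := rfl

@[simp]
theorem walkSum_cons {α : Type*} [AddCommMonoid α] (σ : ℕ) (a : ℕ → α) (u : ℕ → ℕ)
    {v v' w : Fin n} (h : G.Adj v v') (p : G.Walk v' w) :
    walkSum σ a u (.cons h p) = a (place n σ v' (u v') v (u v)) + walkSum σ a u p := rfl

theorem walkSum_congr {α : Type*} [AddCommMonoid α] (σ : ℕ) (a : ℕ → α) {u u' : ℕ → ℕ}
    {v w : Fin n} (p : G.Walk v w) (h : ∀ x ∈ p.support, u x = u' x) :
    walkSum σ a u p = walkSum σ a u' p := by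
  induction p with
  | nil => rfl
  | cons hadj p ih =>
    rw [walkSum_cons, walkSum_cons, ih fun x hx => h x (by simp [hx]), h _ (by simp),
      h _ (by simp)]

theorem walkSum_nonneg {σ : ℕ} {d : ℕ → ℝ} (hd : ∀ p, 0 ≤ d p) (u : ℕ → ℕ) {v w : Fin n}
    (p : G.Walk v w) : 0 ≤ walkSum σ d u p := by
  induction p with
  | nil => exact le_rfl
  | cons hadj p ih => exact add_nonneg (hd _) ih

/-! ### Rounded distances along a walk -/

/-- The entry `d` of the distance matrix is rounded to `k`, in units of `D / N`. -/
structure Rounded (D : ℝ) (N : ℕ) (d : ℝ) (k : ℕ) : Prop where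
  lower : D * k ≤ N * d
  upper : k ≤ N → N * d ≤ D * (k + 1)
  zero : d = 0 → k = 0
  le : k ≤ N + 1

variable {σ N : ℕ} {D : ℝ} {d : ℕ → ℝ} {R : ℕ → ℕ}

theorem mul_walkSum_le (hR : ∀ p < n * σ * (n * σ), Rounded D N (d p) (R p)) {u : ℕ → ℕ}
    (hu : ∀ i, u i < σ) {v w : Fin n} (p : G.Walk v w) :
    D * walkSum σ R u p ≤ N * walkSum σ d u p := by
  induction p with
  | nil => simp
  | @cons v v' w hadj p ih =>
    have := (hR _ (place_lt v'.2 (hu v') v.2 (hu v))).lower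
    rw [walkSum_cons, walkSum_cons]
    push_cast
    linarith

/-- This is the case `D = 0`, where `lower` puts no bound on the rounded value; the field `zero`
takes over. -/
theorem walkSum_eq_zero (hd : ∀ p, 0 ≤ d p)
    (hR : ∀ p < n * σ * (n * σ), Rounded D N (d p) (R p)) {u : ℕ → ℕ} (hu : ∀ i, u i < σ)
    {v w : Fin n} (p : G.Walk v w) (h : walkSum σ d u p ≤ 0) : walkSum σ R u p = 0 := by
  induction p with
  | nil => rfl
  | @cons v v' w hadj p ih =>
    rw [walkSum_cons] at h ⊢
    have h₁ := hd (place n σ v' (u v') v (u v))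
    have h₂ := walkSum_nonneg (σ := σ) hd u p
    rw [ih (by linarith), (hR _ (place_lt v'.2 (hu v') v.2 (hu v))).zero (by linarith)]

/-- For `D > 0` divide `mul_walkSum_le` by `D`. Consequently no digit overflows on a path of cost at
most `D`. -/
theorem walkSum_le_of_le (hD : 0 ≤ D) (hd : ∀ p, 0 ≤ d p)
    (hR : ∀ p < n * σ * (n * σ), Rounded D N (d p) (R p)) {u : ℕ → ℕ} (hu : ∀ i, u i < σ)
    {v w : Fin n} (p : G.Walk v w) (h : walkSum σ d u p ≤ D) : walkSum σ R u p ≤ N := by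
  rcases hD.eq_or_lt with h0 | hpos
  · rw [walkSum_eq_zero hd hR hu p (h0 ▸ h)]
    exact Nat.zero_le _
  · have h₁ := mul_walkSum_le hR hu p
    have h₂ : D * walkSum σ R u p ≤ D * N := by
      calc _ ≤ N * walkSum σ d u p := h₁
        _ ≤ N * D := mul_le_mul_of_nonneg_left h (Nat.cast_nonneg _)
        _ = D * N := mul_comm _ _
    exact_mod_cast le_of_mul_le_mul_left h₂ hpos

/-- Each edge loses at most one unit `D / N`. The hypothesis on the rounded sum excludes capped
entries `N + 1`, for which `upper` says nothing. -/
theorem mul_walkSum_le_add_length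
    (hR : ∀ p < n * σ * (n * σ), Rounded D N (d p) (R p)) {u : ℕ → ℕ} (hu : ∀ i, u i < σ)
    {v w : Fin n} (p : G.Walk v w) (h : walkSum σ R u p ≤ N) :
    N * walkSum σ d u p ≤ D * (walkSum σ R u p + p.length) := by
  induction p with
  | nil => simp
  | @cons v v' w hadj p ih =>
    rw [walkSum_cons] at h
    have h₁ := (hR _ (place_lt v'.2 (hu v') v.2 (hu v))).upper (by omega)
    have h₂ := ih (by omega)
    rw [walkSum_cons, walkSum_cons, SimpleGraph.Walk.length_cons]
    push_cast
    linarith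

end WalkSum

/-! # The states of the dynamic program

A vector `g` of `σ` numbers below `B` at the vertex `i` has the code `∑ l, g l * B ^ l + i * B ^ σ`.
-/

/-- The number with the digits `g 0, …, g (L - 1)` in base `B`. -/
def enc (g : ℕ → ℕ) (B : ℕ) : ℕ → ℕ
  | 0 => 0
  | l + 1 => enc g B l + g l * B ^ l

theorem enc_lt {g : ℕ → ℕ} {B L : ℕ} (h : ∀ l < L, g l < B) : enc g B L < B ^ L := by
  induction L with
  | zero => simp [enc]
  | succ L ih =>
    have h₁ := ih fun l hl => h l (by omega)
    have h₂ := mul_add_lt_mul (h L (by omega)) h₁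
    rw [enc, pow_succ']
    omega

theorem enc_add_div {g : ℕ → ℕ} {B L : ℕ} (hB : 0 < B) (h : ∀ l < L, g l < B) (v : ℕ) :
    (enc g B L + v * B ^ L) / B ^ L = v := by
  rw [Nat.add_mul_div_right _ _ (pow_pos hB L), Nat.div_eq_of_lt (enc_lt h), zero_add]

/-- The leading digit is absorbed into the multiplier, which is why the induction runs over all `v`.
-/
theorem enc_digit {g : ℕ → ℕ} {B L : ℕ} (h : ∀ l < L, g l < B) (v : ℕ) {k : ℕ} (hk : k < L) :
    (enc g B L + v * B ^ L) / B ^ k % B = g k := by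
  have hB : 0 < B := (Nat.zero_le _).trans_lt (h k hk)
  induction L generalizing v with
  | zero => omega
  | succ L ih =>
    have hL : ∀ l < L, g l < B := fun l hl => h l (by omega)
    have e : enc g B (L + 1) + v * B ^ (L + 1) = enc g B L + (g L + v * B) * B ^ L := by
      rw [enc, pow_succ]
      ring
    rw [e]
    rcases Nat.lt_succ_iff_lt_or_eq.1 hk with hk' | rfl
    · exact ih hL _ hk'
    · rw [enc_add_div hB hL, Nat.add_mul_mod_self_right, Nat.mod_eq_of_lt (h k hk)]

/-- The maximum over the points `k < K` of the vertex `i` of the value of `k` in the state `c`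
plus the rounded distance to the `l`-th point of the vertex `j`. -/
def stepVal (n σ B : ℕ) (R : ℕ → ℕ) (c i j l : ℕ) : ℕ → ℕ
  | 0 => 0
  | k + 1 => max (stepVal n σ B R c i j l k) (c / B ^ k % B + R (place n σ i k j l))

theorem le_stepVal {n σ B : ℕ} {R : ℕ → ℕ} {c i j l k K : ℕ} (hk : k < K) :
    c / B ^ k % B + R (place n σ i k j l) ≤ stepVal n σ B R c i j l K := by
  induction K with
  | zero => omega
  | succ K ih =>
    rcases Nat.lt_succ_iff_lt_or_eq.1 hk with hk' | rfl
    · exact (ih hk').trans (le_max_left _ _)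
    · exact le_max_right _ _

theorem exists_stepVal_eq {n σ B : ℕ} {R : ℕ → ℕ} {c i j l K : ℕ} (hK : 0 < K) :
    ∃ k < K, stepVal n σ B R c i j l K = c / B ^ k % B + R (place n σ i k j l) := by
  induction K with
  | zero => omega
  | succ K ih =>
    rcases Nat.eq_zero_or_pos K with rfl | hpos
    · exact ⟨0, by omega, by simp [stepVal]⟩
    · obtain ⟨k, hk, e⟩ := ih hpos
      rcases le_total (stepVal n σ B R c i j l K) (c / B ^ K % B + R (place n σ i K j l)) with h | h
      · exact ⟨K, by omega, max_eq_right h⟩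
      · exact ⟨k, by omega, (max_eq_left h).trans e⟩

/-- The state `c'` extends the state `c` along an edge, with all values below `B`. -/
structure IsStep (n σ B : ℕ) (A R : ℕ → ℕ) (c c' : ℕ) : Prop where
  lt : c' / B ^ σ < n
  adj : A (c / B ^ σ * n + c' / B ^ σ) ≠ 0
  val_lt : ∀ l < σ, stepVal n σ B R c (c / B ^ σ) (c' / B ^ σ) l σ < B
  eq : c' = enc (fun l => stepVal n σ B R c (c / B ^ σ) (c' / B ^ σ) l σ) B σ +
    c' / B ^ σ * B ^ σ

theorem IsStep.digit {n σ B : ℕ} {A R : ℕ → ℕ} {c c' : ℕ} (h : IsStep n σ B A R c c') {l : ℕ}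
    (hl : l < σ) :
    c' / B ^ l % B = stepVal n σ B R c (c / B ^ σ) (c' / B ^ σ) l σ :=
  (congrArg (fun x => x / B ^ l % B) h.eq).trans (enc_digit h.val_lt _ hl)

theorem IsStep.add_le {n σ B : ℕ} {A R : ℕ → ℕ} {c c' : ℕ} (h : IsStep n σ B A R c c') {k l : ℕ}
    (hk : k < σ) (hl : l < σ) :
    c / B ^ k % B + R (place n σ (c / B ^ σ) k (c' / B ^ σ) l) ≤ c' / B ^ l % B := by
  rw [h.digit hl]
  exact le_stepVal hk

/-- The maximum of the first `K` values of the state `c`. -/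
def maxVal (B c : ℕ) : ℕ → ℕ
  | 0 => 0
  | k + 1 => max (maxVal B c k) (c / B ^ k % B)

theorem le_maxVal {B c k K : ℕ} (hk : k < K) : c / B ^ k % B ≤ maxVal B c K := by
  induction K with
  | zero => omega
  | succ K ih =>
    rcases Nat.lt_succ_iff_lt_or_eq.1 hk with hk' | rfl
    · exact (ih hk').trans (le_max_left _ _)
    · exact le_max_right _ _

theorem exists_maxVal_eq {B c K : ℕ} (hK : 0 < K) : ∃ k < K, maxVal B c K = c / B ^ k % B := by
  induction K with
  | zero => omega
  | succ K ih =>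
    rcases Nat.eq_zero_or_pos K with rfl | hpos
    · exact ⟨0, by omega, by simp [maxVal]⟩
    · obtain ⟨k, hk, e⟩ := ih hpos
      rcases le_total (maxVal B c K) (c / B ^ K % B) with h | h
      · exact ⟨K, by omega, max_eq_right h⟩
      · exact ⟨k, by omega, (max_eq_left h).trans e⟩

section Graph

variable {n σ B : ℕ} {G : SimpleGraph (Fin n)} {A R : ℕ → ℕ}

/-- A set of states that contains the empty walk and is closed under steps contains a state for
every path of small cost. -/
theorem exists_state_of_isPath (hσ : 0 < σ) (hA : ∀ i j : Fin n, A (i * n + j) ≠ 0 ↔ G.Adj i j)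
    (hB : 0 < B) {S : ℕ → Prop} {v t : Fin n} (h0 : S (t * B ^ σ))
    (hS : ∀ c c', S c → IsStep n σ B A R c c' → S c') (p : G.Walk v t) (hp : p.IsPath)
    (hlt : ∀ u : ℕ → ℕ, (∀ i, u i < σ) → walkSum σ R u p < B) :
    ∃ c, S c ∧ c / B ^ σ = v ∧ ∀ l < σ, ∃ u : ℕ → ℕ, (∀ i, u i < σ) ∧ u v = l ∧
      walkSum σ R u p = c / B ^ l % B := by
  have hV : 0 < B ^ σ := pow_pos hB σ
  induction p with
  | nil =>
    rename_i t
    refine ⟨_, h0, Nat.mul_div_cancel _ hV, fun l hl => ⟨fun _ => l, fun _ => hl, rfl, ?_⟩⟩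
    have := enc_digit (g := fun _ => 0) (B := B) (L := σ) (fun _ _ => hB) t hl
    have e : ∀ L, enc (fun _ => 0) B L = 0 := fun L => by
      induction L with
      | zero => rfl
      | succ L ih => simp [enc, ih]
    rw [e, zero_add] at this
    rw [this, walkSum_nil]
  | @cons v v' t hadj p ih =>
    rw [SimpleGraph.Walk.cons_isPath_iff] at hp
    obtain ⟨c, hc, hcv, hval⟩ := ih h0 hp.1 fun u hu => by
      have := hlt u hu
      rw [walkSum_cons] at this
      omega
    set g : ℕ → ℕ := fun l => stepVal n σ B R c v' v l σ with hg
    have hu : ∀ l < σ, ∃ u : ℕ → ℕ, (∀ i, u i < σ) ∧ u v = l ∧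
        walkSum σ R u (.cons hadj p) = g l := fun l hl => by
      obtain ⟨k, hk, hgk⟩ := exists_stepVal_eq (n := n) (σ := σ) (B := B) (R := R) (c := c)
        (i := v') (j := v) (l := l) hσ
      obtain ⟨u, hu, huv, hus⟩ := hval k hk
      have hne : (v' : ℕ) ≠ v := fun h => hadj.ne (Fin.ext h).symm
      -- Only the position of `v` is changed. The path is simple, so its tail avoids `v` and keeps
      -- its cost; the maximizing `k` is the position of `v'` in `u`.
      refine ⟨Function.update u v l, fun i => ?_, by simp, ?_⟩
      · rcases eq_or_ne i v with rfl | hi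
        · simpa using hl
        · simpa [hi] using hu i
      · rw [walkSum_cons, walkSum_congr σ R p (u' := u), hus]
        · simp only [hg, hgk, Function.update_self, Function.update_of_ne hne, huv]
          rw [add_comm]
        · intro x hx
          refine Function.update_of_ne (fun h => hp.2 ?_) _ _
          rwa [← Fin.ext h]
    have hgB : ∀ l < σ, g l < B := fun l hl => by
      obtain ⟨u, hu₁, -, hu₂⟩ := hu l hl
      exact hu₂ ▸ hlt u hu₁
    have hdiv : (enc g B σ + v * B ^ σ) / B ^ σ = v := enc_add_div hB hgB v
    refine ⟨enc g B σ + v * B ^ σ, hS c _ hc ⟨?_, ?_, ?_, ?_⟩, hdiv, fun l hl => ?_⟩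
    · rw [hdiv]
      exact v.2
    · rw [hdiv, hcv]
      exact (hA v' v).2 hadj.symm
    · rw [hdiv, hcv]
      exact hgB
    · rw [hdiv, hcv]
    · rw [enc_digit hgB _ hl]
      exact hu l hl

/-- A walk in the graph of states yields a path, which follows the pointers to the successors of
the last occurrences of the vertices. -/
theorem exists_isPath_of_steps (hA : ∀ i j : Fin n, A (i * n + j) ≠ 0 ↔ G.Adj i j)
    {t : Fin n} {Q : ℕ → ℕ} {L : ℕ} {nxt : ℕ → ℕ}
    (hQ : ∀ i < L, IsStep n σ B A R (Q (i + 1)) (Q i)) (hL : Q L / B ^ σ = t)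
    (hn : ∀ i < L, ∃ i', i ≤ i' ∧ i' < L ∧ Q i' / B ^ σ = Q i / B ^ σ ∧
      nxt (Q i / B ^ σ) = Q (i' + 1) / B ^ σ) {v : Fin n} (hv : Q 0 / B ^ σ = v) :
    ∃ P : G.Walk v t, P.IsPath ∧
      (∀ k < P.length, nxt (P.getVert k) = P.getVert (k + 1)) ∧
      ∀ u : ℕ → ℕ, (∀ i, u i < σ) → walkSum σ R u P ≤ Q 0 / B ^ u v % B := by
  have hlt : ∀ i ≤ L, Q i / B ^ σ < n := fun i hi => by
    rcases hi.lt_or_eq with h | rfl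
    · exact (hQ i h).lt
    · exact hL ▸ t.2
  -- In a fixed scenario every step adds a nonnegative rounded distance, so the value at the
  -- scenario's point grows from `Q L` back to `Q 0`. Jumping over a closed piece of the walk
  -- therefore never raises the cost.
  have hmono : ∀ u : ℕ → ℕ, (∀ i, u i < σ) → ∀ i j, i ≤ j → j ≤ L →
      Q j / B ^ u (Q j / B ^ σ) % B ≤ Q i / B ^ u (Q i / B ^ σ) % B := fun u hu i j hij => by
    induction j, hij using Nat.le_induction with
    | base => exact fun _ => le_rfl
    | succ j hij ih =>
      intro hj
      have := (hQ j (by omega)).add_le (hu (Q (j + 1) / B ^ σ)) (hu (Q j / B ^ σ))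
      have := ih (by omega)
      omega
  have hlast : ∀ i ≤ L, ∃ j, i ≤ j ∧ j ≤ L ∧ Q j / B ^ σ = Q i / B ^ σ ∧
      ∀ j', j < j' → j' ≤ L → Q j' / B ^ σ ≠ Q i / B ^ σ := fun i hi => by
    classical
    refine ⟨Nat.findGreatest (fun j => Q j / B ^ σ = Q i / B ^ σ) L, Nat.le_findGreatest hi rfl,
      Nat.findGreatest_le _, Nat.findGreatest_spec (P := fun j => Q j / B ^ σ = Q i / B ^ σ) hi rfl,
      fun j' h₁ h₂ => Nat.findGreatest_is_greatest
        (P := fun j => Q j / B ^ σ = Q i / B ^ σ) h₁ h₂⟩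
  -- Start at the last occurrence `i` of `v`, take one step to `v'`, and jump to the last occurrence
  -- of `v'`. The clause on the support says that only positions from `i` on are used, which makes
  -- the result simple.
  have main : ∀ r i, i + r = L → ∀ v : Fin n, Q i / B ^ σ = v →
      (∀ j, i < j → j ≤ L → Q j / B ^ σ ≠ v) →
      ∃ P : G.Walk v t, P.IsPath ∧
        (∀ k < P.length, nxt (P.getVert k) = P.getVert (k + 1)) ∧
        (∀ x ∈ P.support, ∃ j, i ≤ j ∧ j ≤ L ∧ Q j / B ^ σ = (x : Fin n)) ∧
        ∀ u : ℕ → ℕ, (∀ i, u i < σ) → walkSum σ R u P ≤ Q i / B ^ u v % B := by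
    intro r
    induction r using Nat.strong_induction_on with
    | _ r ih =>
      intro i hi v hv hl
      by_cases hvt : v = t
      · subst hvt
        refine ⟨.nil, .nil, fun k hk => by simp at hk, fun x hx => ?_, fun u _ => by simp⟩
        obtain rfl : x = v := by simpa using hx
        exact ⟨i, le_rfl, by omega, hv⟩
      have hiL : i < L := by
        rcases (show i ≤ L by omega).lt_or_eq with h | rfl
        · exact h
        · exact absurd (Fin.ext (hv.symm.trans hL)) hvt
      obtain ⟨i', h₁, h₂, h₃, h₄⟩ := hn i hiL
      -- No later occurrence of `v` exists, so the pointer at `v` was set at position `i` itself.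
      obtain rfl : i' = i := by
        by_contra hne
        exact hl i' (by omega) h₂.le (h₃.trans hv)
      obtain ⟨j, hj₁, hj₂, hj₃, hj₄⟩ := hlast (i' + 1) hiL
      set v' : Fin n := ⟨Q (i' + 1) / B ^ σ, hlt _ hiL⟩ with hv'
      obtain ⟨P, hP, hPn, hPs, hPu⟩ := ih (L - j) (by omega) j (by omega) v' hj₃ hj₄
      have hstep := hQ i' hiL
      have hadj : G.Adj v v' := by
        have := hstep.adj
        rw [hv] at this
        exact ((hA v' v).1 this).symm
      refine ⟨.cons hadj P, hP.cons fun hmem => ?_, fun k hk => ?_, fun x hx => ?_,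
        fun u hu => ?_⟩
      · obtain ⟨j', h₁, h₂, h₃⟩ := hPs v hmem
        exact hl j' (by omega) h₂ h₃
      · rcases k with _ | k
        · simpa [hv] using h₄
        · simpa using hPn k (by simpa using hk)
      · rw [SimpleGraph.Walk.support_cons, List.mem_cons] at hx
        rcases hx with rfl | hx
        · exact ⟨i', le_rfl, by omega, hv⟩
        · obtain ⟨j', h₁, h₂, h₃⟩ := hPs x hx
          exact ⟨j', by omega, h₂, h₃⟩
      · have e₁ := hPu u hu
        have e₂ := hmono u hu (i' + 1) j hj₁ hj₂
        have e₃ := hstep.add_le (hu (Q (i' + 1) / B ^ σ)) (hu (Q i' / B ^ σ))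
        rw [hj₃] at e₂
        rw [hv] at e₃
        simp only [walkSum_cons, hv'] at e₁ ⊢
        omega
  obtain ⟨j, hj₁, hj₂, hj₃, hj₄⟩ := hlast 0 (Nat.zero_le _)
  rw [hv] at hj₃ hj₄
  obtain ⟨P, hP, hPn, -, hPu⟩ := main (L - j) j (by omega) v hj₃ hj₄
  refine ⟨P, hP, hPn, fun u hu => (hPu u hu).trans ?_⟩
  have := hmono u hu 0 j hj₁ hj₂
  rwa [hj₃, hv] at this

end Graph

/-! # Breadth-first search -/

/-- The state of a search from `c₀` in a graph on `{0, …, M - 1}`: the queue `q 0, …, q (τ - 1)`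
of the vertices found, with the places `par` of their predecessors, and the marks `vis`. -/
structure Search (M c₀ : ℕ) (Step : ℕ → ℕ → Prop) (vis q par : ℕ → ℕ) (τ : ℕ) : Prop where
  pos : 0 < τ
  first : q 0 = c₀
  lt : ∀ p < τ, q p < M
  vis_ne : ∀ p < τ, vis (q p) ≠ 0
  exists_of_vis : ∀ c, vis c ≠ 0 → ∃ p < τ, q p = c
  inj : ∀ p < τ, ∀ p' < τ, q p = q p' → p = p'
  step : ∀ p < τ, 0 < p → par p < p ∧ Step (q (par p)) (q p)

namespace Search

variable {M c₀ : ℕ} {Step : ℕ → ℕ → Prop} {vis q par : ℕ → ℕ} {τ : ℕ}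

theorem start (h : c₀ < M) :
    Search M c₀ Step (Function.update (fun _ => 0) c₀ 1) (Function.update q 0 c₀) par 1 where
  pos := one_pos
  first := by simp
  lt p hp := by
    obtain rfl : p = 0 := by omega
    simpa using h
  vis_ne p hp := by
    obtain rfl : p = 0 := by omega
    simp
  exists_of_vis c hc := by
    refine ⟨0, one_pos, ?_⟩
    by_contra hne
    simp only [Function.update_self] at hne
    exact hc (Function.update_of_ne (Ne.symm hne) _ _)
  inj p hp p' hp' _ := by omega
  step p hp hp' := by omega

/-- The queue is injective into `{0, …, M - 1}`. This bounds both the number of expansions and the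
addresses in the queue. -/
theorem le (h : Search M c₀ Step vis q par τ) : τ ≤ M := by
  have := Finset.card_le_card_of_injOn (s := Finset.range τ) (t := Finset.range M) q
    (fun p hp => Finset.mem_coe.2 (Finset.mem_range.2
      (h.lt p (Finset.mem_range.1 (Finset.mem_coe.1 hp)))))
    (fun p hp p' hp' e => h.inj p (Finset.mem_range.1 (Finset.mem_coe.1 hp)) p'
      (Finset.mem_range.1 (Finset.mem_coe.1 hp')) e)
  simpa using this

theorem push (h : Search M c₀ Step vis q par τ) {k c : ℕ} (hk : k < τ) (hs : Step (q k) c)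
    (hc : c < M) (hv : vis c = 0) :
    Search M c₀ Step (Function.update vis c 1) (Function.update q τ c)
      (Function.update par τ k) (τ + 1) := by
  have hq : ∀ p < τ, Function.update q τ c p = q p := fun p hp =>
    Function.update_of_ne hp.ne _ _
  have hcases : ∀ p < τ + 1, p < τ ∨ p = τ := fun p hp => by omega
  refine ⟨by omega, (hq 0 h.pos).trans h.first, fun p hp => ?_, fun p hp => ?_,
    fun x hx => ?_, fun p hp p' hp' e => ?_, fun p hp hp' => ?_⟩
  · rcases hcases p hp with hp | rfl
    · exact (hq p hp).symm ▸ h.lt p hp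
    · simpa using hc
  · rcases hcases p hp with hp | rfl
    · rw [hq p hp]
      have : q p ≠ c := fun e => h.vis_ne p hp (e ▸ hv)
      rw [Function.update_of_ne this]
      exact h.vis_ne p hp
    · simp
  · by_cases hxc : x = c
    · exact ⟨τ, by omega, by simp [hxc]⟩
    · rw [Function.update_of_ne hxc] at hx
      obtain ⟨p, hp, e⟩ := h.exists_of_vis x hx
      exact ⟨p, by omega, (hq p hp).trans e⟩
  · rcases hcases p hp with hp | rfl <;> rcases hcases p' hp' with hp' | rfl
    · rw [hq p hp, hq p' hp'] at e
      exact h.inj p hp p' hp' e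
    · rw [hq p hp, Function.update_self] at e
      exact absurd (e ▸ hv) (h.vis_ne p hp)
    · rw [hq p' hp', Function.update_self] at e
      exact absurd (e ▸ hv) (h.vis_ne p' hp')
    · rfl
  · rcases hcases p hp with hp | rfl
    · have hpar := h.step p hp hp'
      rw [Function.update_of_ne hp.ne, hq p hp, hq _ (hpar.1.trans hp)]
      exact hpar
    · rw [Function.update_self, Function.update_self, hq k hk]
      exact ⟨hk, hs⟩

end Search

/-! # Shortest walks with respect to the largest edge weights -/

/-- The maximum of the first `y` distances between points of the vertices `i` and `j`. -/
noncomputable def maxDist (n σ : ℕ) (d : ℕ → ℝ) (i j : ℕ) : ℕ → ℝ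
  | 0 => 0
  | y + 1 => max (maxDist n σ d i j y) (d (place n σ i (y / σ) j (y % σ)))

theorem le_maxDist {n σ : ℕ} {d : ℕ → ℝ} {i j k l : ℕ} (hk : k < σ) (hl : l < σ) :
    d (place n σ i k j l) ≤ maxDist n σ d i j (σ * σ) := by
  have H : ∀ Y, ∀ y < Y, d (place n σ i (y / σ) j (y % σ)) ≤ maxDist n σ d i j Y := by
    intro Y
    induction Y with
    | zero => intro y hy; omega
    | succ Y ih =>
      intro y hy
      rcases Nat.lt_succ_iff_lt_or_eq.1 hy with hy' | rfl
      · exact (ih y hy').trans (le_max_left _ _)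
      · exact le_max_right _ _
  have := H (σ * σ) (k * σ + l) (mul_add_lt_mul hk hl)
  rwa [mul_comm k, Nat.mul_add_div (by omega), Nat.div_eq_of_lt hl, Nat.mul_add_mod,
    Nat.mod_eq_of_lt hl, add_zero] at this

theorem maxDist_le {n σ : ℕ} {d : ℕ → ℝ} {i j : ℕ} {c : ℝ} (hc : 0 ≤ c)
    (h : ∀ k < σ, ∀ l < σ, d (place n σ i k j l) ≤ c) : maxDist n σ d i j (σ * σ) ≤ c := by
  have H : ∀ Y ≤ σ * σ, maxDist n σ d i j Y ≤ c := by
    intro Y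
    induction Y with
    | zero => exact fun _ => hc
    | succ Y ih =>
      intro hY
      have hσ : 0 < σ := Nat.pos_of_ne_zero (by rintro rfl; omega)
      exact max_le (ih (by omega))
        (h _ (Nat.div_lt_of_lt_mul (by omega)) _ (Nat.mod_lt _ hσ))
  exact H _ le_rfl

section BellmanFord

variable {n : ℕ} {G : SimpleGraph (Fin n)}

/-- The weight of a walk. -/
noncomputable def weight (w : ℕ → ℕ → ℝ) : ∀ {v t : Fin n}, G.Walk v t → ℝ
  | _, _, .nil => 0
  | v, _, .cons (v := v') _ p => w v' v + weight w p

@[simp]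
theorem weight_nil (w : ℕ → ℕ → ℝ) (v : Fin n) : weight w (.nil : G.Walk v v) = 0 := rfl

@[simp]
theorem weight_cons (w : ℕ → ℕ → ℝ) {v v' t : Fin n} (h : G.Adj v v') (p : G.Walk v' t) :
    weight w (.cons h p) = w v' v + weight w p := rfl

/-- The state of the algorithm of Bellman and Ford after `x` relaxations: `b` contains weights of
walks to `t`, for the vertices marked by `f`. -/
structure Relaxed (G : SimpleGraph (Fin n)) (t : Fin n) (w : ℕ → ℕ → ℝ) (f : ℕ → ℕ) (b : ℕ → ℝ)
    (x : ℕ) : Prop where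
  sound : ∀ v : Fin n, f v ≠ 0 → ∃ P : G.Walk v t, b v = weight w P
  base : f t ≠ 0 ∧ b t ≤ 0
  complete : ∀ (r : ℕ) (i j : Fin n), r * (n * n) + (i * n + j) < x → G.Adj j i →
    ∀ P : G.Walk i t, P.length ≤ r → f j ≠ 0 ∧ b j ≤ w i j + weight w P

namespace Relaxed

variable {t : Fin n} {w : ℕ → ℕ → ℝ} {f : ℕ → ℕ} {b : ℕ → ℝ} {x : ℕ}

theorem start : Relaxed G t w (Function.update (fun _ => 0) t 1) (fun _ => 0) 0 where
  sound v hv := by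
    obtain rfl : v = t := by
      by_contra hne
      exact hv (Function.update_of_ne (fun h => hne (Fin.ext h)) _ _)
    exact ⟨.nil, rfl⟩
  base := by simp
  complete r i j h := by omega

/-- Split off the first edge, from `i` to `i'`. Its relaxation in round `r` has index `r n² + i' n +
i < (r + 1) n²`, so it has been carried out. -/
theorem le_weight (h : Relaxed G t w f b x) {r : ℕ} (hx : r * (n * n) ≤ x) {i : Fin n}
    (P : G.Walk i t) (hP : P.length ≤ r) : f i ≠ 0 ∧ b i ≤ weight w P := by
  cases P with
  | nil => exact h.base
  | @cons _ i' _ hadj P =>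
    rw [SimpleGraph.Walk.length_cons] at hP
    obtain ⟨r, rfl⟩ : ∃ r', r = r' + 1 := ⟨r - 1, by omega⟩
    refine h.complete r i' i ?_ hadj P (by omega)
    have := mul_add_lt_mul i'.2 i.2
    rw [add_mul] at hx
    omega

/-- A relaxation that changes nothing. -/
theorem skip (h : Relaxed G t w f b x) {r : ℕ} {i j : Fin n} (hx : x = r * (n * n) + (i * n + j))
    (hadj : G.Adj j i → f i ≠ 0 → f j ≠ 0 ∧ b j ≤ b i + w i j) :
    Relaxed G t w f b (x + 1) := by
  refine ⟨h.sound, h.base, fun r' i' j' hlt ha P hP => ?_⟩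
  rcases Nat.lt_succ_iff_lt_or_eq.1 hlt with hlt | heq
  · exact h.complete r' i' j' hlt ha P hP
  -- The index is a mixed-radix number, hence the new index determines the round and both vertices.
  · have hn : 0 < n := i.pos
    have hb := mul_add_lt_mul i.2 j.2
    have hb' := mul_add_lt_mul i'.2 j'.2
    have hij : (i' : ℕ) * n + j' = i * n + j := by
      have := congrArg (· % (n * n)) (heq.trans hx)
      simpa [Nat.add_mod, Nat.mod_eq_of_lt hb, Nat.mod_eq_of_lt hb']
        using this
    have hr : r' = r := by
      have h₁ : r' * (n * n) = r * (n * n) := by omega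
      exact Nat.eq_of_mul_eq_mul_right (Nat.mul_pos hn hn) h₁
    have hj : j' = j := by
      have := congrArg (· % n) hij
      exact Fin.ext (by simpa [Nat.add_mod, Nat.mod_eq_of_lt j.2, Nat.mod_eq_of_lt j'.2]
        using this)
    have hi : i' = i := by
      rw [hj] at hij
      exact Fin.ext (Nat.eq_of_mul_eq_mul_right hn (by omega))
    subst hr hi hj
    obtain ⟨h₁, h₂⟩ := h.le_weight (r := r') (by omega) P hP
    obtain ⟨h₃, h₄⟩ := hadj ha h₁
    exact ⟨h₃, by linarith⟩

/-- Values only decrease and marks only appear, so the old guarantees persist. In the updated arrays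
the same relaxation would change nothing, and `skip` applies. -/
theorem relax (h : Relaxed G t w f b x) {r : ℕ} {i j : Fin n}
    (hx : x = r * (n * n) + (i * n + j)) (hadj : G.Adj j i) (hi : f i ≠ 0)
    (hj : ¬ (f j ≠ 0 ∧ b j ≤ b i + w i j)) :
    Relaxed G t w (Function.update f j 1) (Function.update b j (b i + w i j)) (x + 1) := by
  have hf : ∀ v, f v ≠ 0 → Function.update f j 1 v ≠ 0 := fun v hv => by
    by_cases hvj : v = j
    · simp [hvj]
    · rwa [Function.update_of_ne hvj]
  have hb : ∀ v, f v ≠ 0 → Function.update b j (b i + w i j) v ≤ b v := fun v hv => by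
    by_cases hvj : v = j
    · subst hvj
      rw [Function.update_self]
      by_contra hlt
      exact hj ⟨hv, (not_le.1 hlt).le⟩
    · rw [Function.update_of_ne hvj]
  -- There are no loops, so writing at `j` leaves the value at `i` intact.
  have hne : (i : ℕ) ≠ j := fun e => hadj.ne (Fin.ext e).symm
  refine skip (r := r) (i := i) (j := j) ⟨fun v hv => ?_,
    ⟨hf _ h.base.1, (hb _ h.base.1).trans h.base.2⟩,
    fun r' i' j' hlt ha P hP => ?_⟩ hx fun _ _ => ?_
  · by_cases hvj : v = j
    · subst hvj
      obtain ⟨P, hP⟩ := h.sound i hi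
      exact ⟨.cons hadj P, by rw [Function.update_self, weight_cons, hP, add_comm]⟩
    · have hvj' : (v : ℕ) ≠ j := fun e => hvj (Fin.ext e)
      rw [Function.update_of_ne hvj'] at hv ⊢
      exact h.sound v hv
  · obtain ⟨h₁, h₂⟩ := h.complete r' i' j' hlt ha P hP
    exact ⟨hf _ h₁, (hb _ h₁).trans h₂⟩
  · simp [Function.update_of_ne hne]

end Relaxed

variable {σ : ℕ} {d : ℕ → ℝ}

theorem walkSum_le_weight {u : ℕ → ℕ} (hu : ∀ i, u i < σ) {v t : Fin n} (P : G.Walk v t) :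
    walkSum σ d u P ≤ weight (fun i j => maxDist n σ d i j (σ * σ)) P := by
  induction P with
  | nil => exact le_rfl
  | cons hadj P ih => exact add_le_add (le_maxDist (hu _) (hu _)) ih

/-- Each single edge weight is at most `c`: some scenario realizes it and all other edges cost at
least 0. -/
theorem weight_le_length_mul (hσ : 0 < σ) (hd : ∀ p, 0 ≤ d p) {v t : Fin n} (P : G.Walk v t)
    {c : ℝ} (hc : ∀ u : ℕ → ℕ, (∀ i, u i < σ) → walkSum σ d u P ≤ c) :
    weight (fun i j => maxDist n σ d i j (σ * σ)) P ≤ P.length * c := by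
  induction P with
  | nil => simp
  | @cons v v' t hadj P ih =>
    have hc0 : 0 ≤ c :=
      (walkSum_nonneg (σ := σ) hd (fun _ => 0) _).trans (hc (fun _ => 0) fun _ => hσ)
    have h₁ := ih fun u hu => by
      have := hc u hu
      rw [walkSum_cons] at this
      linarith [hd (place n σ v' (u v') v (u v))]
    have h₂ : maxDist n σ d v' v (σ * σ) ≤ c := maxDist_le hc0 fun k hk l hl => by
      have hne : (v' : ℕ) ≠ v := fun h => hadj.ne (Fin.ext h).symm
      -- The scenario puts `v` at its `l`-th point and every other vertex, in particular `v'`, at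
      -- its `k`-th.
      have := hc (fun i => if i = v then l else k) fun i => by split_ifs <;> assumption
      rw [walkSum_cons] at this
      simp only [if_neg hne, if_true] at this
      linarith [walkSum_nonneg (σ := σ) hd (fun i => if i = (v : ℕ) then l else k) P]
    rw [weight_cons, SimpleGraph.Walk.length_cons]
    push_cast
    linarith

end BellmanFord

/-! # The approximation ratio -/

section Approx

variable {n : ℕ} {G : SimpleGraph (Fin n)} {σ N : ℕ} {D ε : ℝ} {d : ℕ → ℝ} {R : ℕ → ℕ}

/-- Writing `d` and `R` for exact and rounded sums: `N d(P) ≤ D (R(P) + n) ≤ D R(Q) + D n ≤ N c + n²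
c ≤ N (1 + ε) c`. The estimate `D ≤ n c` turns the rounding error into a relative one. -/
theorem walkSum_le_mul_of_rounded (hD : 0 ≤ D) (hN : 0 < N) (hε : (n : ℝ) * n ≤ N * ε)
    (hR : ∀ p < n * σ * (n * σ), Rounded D N (d p) (R p)) {s t : Fin n} {P Q : G.Walk s t}
    (hP : P.IsPath) {u u' : ℕ → ℕ} (hu : ∀ i, u i < σ) (hu' : ∀ i, u' i < σ)
    (hPN : walkSum σ R u P ≤ N) (hPQ : walkSum σ R u P ≤ walkSum σ R u' Q) {c : ℝ} (hc0 : 0 ≤ c)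
    (hQ : walkSum σ d u' Q ≤ c) (hDc : D ≤ n * c) : walkSum σ d u P ≤ (1 + ε) * c := by
  have h₁ := mul_walkSum_le_add_length hR hu P hPN
  have h₂ := mul_walkSum_le hR hu' Q
  have h₃ : (P.length : ℝ) ≤ n := by
    exact_mod_cast (by simpa using hP.length_lt : P.length < n).le
  have h₄ : D * walkSum σ R u P ≤ D * walkSum σ R u' Q :=
    mul_le_mul_of_nonneg_left (by exact_mod_cast hPQ) hD
  have h₅ : D * P.length ≤ D * n := mul_le_mul_of_nonneg_left h₃ hD
  have h₆ : D * n ≤ n * c * n := mul_le_mul_of_nonneg_right hDc (Nat.cast_nonneg _)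
  have h₇ : (n : ℝ) * n * c ≤ N * ε * c := mul_le_mul_of_nonneg_right hε hc0
  have hN' : (0 : ℝ) < N := by exact_mod_cast hN
  have h₈ : N * walkSum σ d u' Q ≤ N * c := mul_le_mul_of_nonneg_left hQ hN'.le
  refine le_of_mul_le_mul_left ?_ hN'
  calc (N : ℝ) * walkSum σ d u P ≤ D * (walkSum σ R u P + P.length) := h₁
    _ ≤ N * ((1 + ε) * c) := by linarith

end Approx

/-! # The instance in memory -/

namespace Instance

variable {M : Type*} [MetricSpace M] (I : Instance M)

theorem size_le_sigma (i : Fin I.n) : I.size i ≤ I.sigma :=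
  Finset.le_sup (f := I.size) (Finset.mem_univ i)

theorem n_pos : 0 < I.n := I.s.pos

theorem sigma_pos : 0 < I.sigma := (I.size_pos I.s).trans_le (I.size_le_sigma I.s)

theorem adjArr_ne_zero (i j : Fin I.n) : I.adjArr (i * I.n + j) ≠ 0 ↔ I.G.Adj i j := by
  classical
  have hn := I.n_pos
  unfold adjArr
  constructor
  · intro h
    obtain ⟨i', j', e, hadj⟩ : ∃ i' j' : Fin I.n, (i : ℕ) * I.n + j = i' * I.n + j' ∧
        I.G.Adj i' j' := by
      by_contra hne
      exact h (if_neg hne)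
    have h₁ := congrArg (· / I.n) e
    have h₂ := congrArg (· % I.n) e
    simp only [mul_comm _ I.n, Nat.mul_add_div hn, Nat.mul_add_mod, Nat.div_eq_of_lt j.2,
      Nat.div_eq_of_lt j'.2, Nat.mod_eq_of_lt j.2, Nat.mod_eq_of_lt j'.2, add_zero] at h₁ h₂
    rwa [Fin.ext h₁, Fin.ext h₂]
  · intro h
    rw [if_pos ⟨i, j, rfl, h⟩]
    exact one_ne_zero

theorem adjArr_le_one (p : ℕ) : I.adjArr p ≤ 1 := by
  unfold adjArr
  split_ifs <;> simp

theorem pointAt_eq_some {i : Fin I.n} {k : ℕ} (hk : k < I.size i) :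
    I.pointAt (i * I.sigma + k) = some (I.loc i ⟨k, hk⟩) := by
  have hkσ := hk.trans_le (I.size_le_sigma i)
  have h₁ : ((i : ℕ) * I.sigma + k) / I.sigma = i := by
    rw [mul_comm, Nat.mul_add_div I.sigma_pos, Nat.div_eq_of_lt hkσ, add_zero]
  have h₂ : ((i : ℕ) * I.sigma + k) % I.sigma = k := by
    rw [mul_comm, Nat.mul_add_mod, Nat.mod_eq_of_lt hkσ]
  have e : ∀ (a b : ℕ) (_ : a = i) (_ : b = k) (ha : a < I.n) (hb : b < I.size ⟨a, ha⟩),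
      I.loc ⟨a, ha⟩ ⟨b, hb⟩ = I.loc i ⟨k, hk⟩ := by
    rintro _ _ rfl rfl _ _
    rfl
  unfold pointAt
  simp only [h₁, h₂, hk, Fin.is_lt, Fin.eta, dif_pos, Option.some.injEq]
  exact e _ _ h₁ rfl _ _

theorem pointAt_eq_none {i : Fin I.n} {k : ℕ} (hkσ : k < I.sigma) (hk : ¬ k < I.size i) :
    I.pointAt (i * I.sigma + k) = none := by
  have h₁ : ((i : ℕ) * I.sigma + k) / I.sigma = i := by
    rw [mul_comm, Nat.mul_add_div I.sigma_pos, Nat.div_eq_of_lt hkσ, add_zero]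
  have h₂ : ((i : ℕ) * I.sigma + k) % I.sigma = k := by
    rw [mul_comm, Nat.mul_add_mod, Nat.mod_eq_of_lt hkσ]
  unfold pointAt
  simp [h₁, h₂, hk]

theorem distArr_nonneg (p : ℕ) : 0 ≤ I.distArr p := by
  unfold distArr
  split
  · exact dist_nonneg
  · exact le_rfl

theorem distArr_place {i j : Fin I.n} {k l : ℕ} (hl : l < I.sigma) :
    I.distArr (place I.n I.sigma i k j l) =
      match I.pointAt (i * I.sigma + k), I.pointAt (j * I.sigma + l) with
      | some x, some y => dist x y
      | _, _ => 0 := by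
  have hlt : (j : ℕ) * I.sigma + l < I.n * I.sigma := mul_add_lt_mul j.2 hl
  have h₁ : place I.n I.sigma i k j l / (I.n * I.sigma) = i * I.sigma + k := by
    rw [place, mul_comm, Nat.mul_add_div (by omega), Nat.div_eq_of_lt hlt, add_zero]
  have h₂ : place I.n I.sigma i k j l % (I.n * I.sigma) = j * I.sigma + l := by
    rw [place, mul_comm, Nat.mul_add_mod, Nat.mod_eq_of_lt hlt]
  unfold distArr
  rw [h₁, h₂]

theorem costIn_cons (u : I.Scenario) {v v' t : Fin I.n} (h : I.G.Adj v v') (p : I.G.Walk v' t) :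
    I.costIn u (.cons h p) = dist (I.loc v (u v)) (I.loc v' (u v')) + I.costIn u p := by
  simp [costIn, edgeCost]

/-- An index beyond `size i` denotes a missing point, all of whose listed distances are 0. Replacing
it by the point 0 can only raise the sum, so padding every vertex to `σ` points is harmless and the
program need not read the sizes. -/
theorem walkSum_le_cost {u : ℕ → ℕ} (hu : ∀ i, u i < I.sigma) {v t : Fin I.n}
    (P : I.G.Walk v t) : walkSum I.sigma I.distArr u P ≤ I.cost P := by
  let u' : I.Scenario := fun i => if h : u i < I.size i then ⟨u i, h⟩ else ⟨0, I.size_pos i⟩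
  suffices H : ∀ {v t : Fin I.n} (P : I.G.Walk v t),
      walkSum I.sigma I.distArr u P ≤ I.costIn u' P from
    (H P).trans (Finset.le_sup' (fun u : I.Scenario => I.costIn u P) (Finset.mem_univ u'))
  intro v t P
  induction P with
  | nil => exact le_rfl
  | @cons v v' t hadj p ih =>
    rw [walkSum_cons, costIn_cons]
    refine add_le_add ?_ ih
    rw [I.distArr_place (hu v)]
    by_cases h' : u v' < I.size v'
    · by_cases h : u v < I.size v
      · rw [I.pointAt_eq_some h', I.pointAt_eq_some h, dist_comm]
        simp [u', h, h']
      · rw [I.pointAt_eq_some h', I.pointAt_eq_none (hu v) h]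
        exact dist_nonneg
    · rw [I.pointAt_eq_none (hu v') h']
      exact dist_nonneg

theorem exists_walkSum_eq_cost {v t : Fin I.n} (P : I.G.Walk v t) :
    ∃ u : ℕ → ℕ, (∀ i, u i < I.sigma) ∧ walkSum I.sigma I.distArr u P = I.cost P := by
  obtain ⟨u, -, hu⟩ := Finset.exists_mem_eq_sup' Finset.univ_nonempty
    (fun u : I.Scenario => I.costIn u P)
  let u' : ℕ → ℕ := fun i => if h : i < I.n then u ⟨i, h⟩ else 0
  have e : ∀ i : Fin I.n, u' i = u i := fun i => by simp [u']
  have hu' : ∀ i, u' i < I.sigma := fun i => by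
    by_cases h : i < I.n
    · simpa [u', h] using (u ⟨i, h⟩).2.trans_le (I.size_le_sigma _)
    · simpa [u', h] using I.sigma_pos
  refine ⟨u', hu', ?_⟩
  rw [cost, hu]
  clear hu
  induction P with
  | nil => rfl
  | @cons v v' t hadj p ih =>
    rw [walkSum_cons, costIn_cons, ih, I.distArr_place (hu' v), e, e, I.pointAt_eq_some (u v).2,
      I.pointAt_eq_some (u v').2, dist_comm]

theorem cost_nonneg {v t : Fin I.n} (P : I.G.Walk v t) : 0 ≤ I.cost P := by
  obtain ⟨u, -, e⟩ := I.exists_walkSum_eq_cost P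
  exact e ▸ walkSum_nonneg I.distArr_nonneg u P

end Instance

/-! # The program -/

/-- The test `e < f`. -/
def Test.lt (e f : WExpr) : Test := .not (.le f e)

/-- Compute the number of rounding levels in word register 4. -/
def levelsProg : Program :=
  .seq (.setReal 1 .zero)
  (.seq (.forLoop 7 (.mul (.reg 0) (.reg 0)) (.setReal 1 (.add (.reg 1) .one)))
  (.seq (.seq (.setWord 4 (.const 1)) (.setReal 2 (.reg 0)))
  (.loop (.not (.rle (.reg 1) (.reg 2)))
    (.seq (.setReal 2 (.add (.reg 2) (.reg 0))) (.setWord 4 (.add (.reg 4) (.const 1)))))))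

/-- The hypotheses say that `N` is the least positive integer with `n² ≤ N ε`. Without
multiplication or conversion of reals, `n²` is built as a sum of ones, and multiples of `ε` are
accumulated until they reach it. -/
theorem runs_levelsProg {W K n N : ℕ} {ε : ℝ} {m : Store} (hn : m.word 0 = n)
    (hε : m.real 0 = ε) (hN : 0 < N) (hNε : (n : ℝ) * n ≤ N * ε)
    (hlt : ∀ k : ℕ, 0 < k → k < N → k * ε < (n : ℝ) * n) (hK : n * n ≤ K) (hK' : N ≤ K)
    (hW : K ≤ W) (hnn : 0 < n) :
    Runs W levelsProg m (100 * K) (fun m' => m'.word 4 = N) := by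
  have hnK : n ≤ K := (Nat.le_mul_self n).trans hK
  refine (Runs.seq (R := fun m' => m'.real 1 = 0) (t₁ := 2) (Runs.of_wp
    (by simp [Program.wp, RExpr.Fits, RExpr.eval]) (by decide)) fun m₁ hF₁ h₁ => ?_).mono
    (t₁ := 2 + (n * n * (3 + 4 + 8) + (3 + 6) + (2 + 2 + (N * (4 + 8 + 1) + 5))))
    (by linarith) fun _ _ h => h
  refine Runs.seq (R := fun m' => m'.real 1 = (n : ℝ) * n) ((Runs.forLoop
    (fun k m' => m'.real 1 = k) (n * n) 4 rfl (by omega) (fun _ _ _ h => h)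
    ?_ (by simpa using h₁) ?_).mono le_rfl ?_) fun m₂ hF₂ h₂ => ?_
  · intro m' hF
    simp [WExpr.Fits, WExpr.eval, hF.word 0 rfl, hF₁.word 0 rfl, hn]
    omega
  · intro k m' hk hF hx hI
    refine Runs.of_wp ?_ (by decide)
    simp [Program.wp, RExpr.Fits, RExpr.eval, hI]
  · intro m' hF h
    simpa using h
  refine Runs.seq (R := fun m' => m'.word 4 = 1 ∧ m'.real 2 = ε) (t₁ := 4)
    (Runs.of_wp ?_ (by decide)) fun m₃ hF₃ h₃ => ?_
  · simp [Program.wp, RExpr.Fits, RExpr.eval, WExpr.Fits, WExpr.eval, hF₂.real 0 rfl,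
      hF₁.real 0 rfl, hε]
    omega
  refine (Runs.loop (fun k m' => m'.word 4 = k + 1 ∧ m'.real 2 = (k + 1 : ℕ) * ε ∧
    k < N) N 8 ?_ ?_ ?_).mono le_rfl ?_
  · simp [h₃, hN]
  · intros
    simp [Test.Fits, RExpr.Fits]
  · rintro k m' hk hF ⟨h₄, h₅, h₆⟩ hb
    simp only [Test.Holds, RExpr.eval, hF.real 1 rfl, hF₃.real 1 rfl, h₂, h₅] at hb
    have hkN : k + 1 < N := by
      by_contra hge
      obtain rfl : k + 1 = N := by omega
      exact hb hNε
    refine ⟨h₆, Runs.of_wp ?_ (by decide)⟩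
    simp [Program.wp, RExpr.Fits, RExpr.eval, WExpr.Fits, WExpr.eval, hF.real 0 rfl,
      hF₃.real 0 rfl, hF₂.real 0 rfl, hF₁.real 0 rfl, hε, h₄, h₅]
    refine ⟨by omega, by ring, hkN⟩
  · rintro m' hF ⟨k, hk, ⟨h₄, h₅, h₆⟩, hb⟩
    simp only [Test.Holds, RExpr.eval, hF.real 1 rfl, hF₃.real 1 rfl, h₂, h₅, not_not] at hb
    by_contra hne
    exact absurd hb (not_le.2 (hlt (k + 1) (by omega) (by omega)))

/-- The place of the pair of the `k`-th point of `i` and the `l`-th point of `j`. -/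
def pairPlace (i k j l : WExpr) : WExpr :=
  .add (.mul (.add (.mul i (.reg 3)) k) (.mul (.reg 0) (.reg 3))) (.add (.mul j (.reg 3)) l)

theorem eval_pairPlace {m : Store} {n σ : ℕ} (hn : m.word 0 = n) (hσ : m.word 3 = σ)
    (i k j l : WExpr) :
    (pairPlace i k j l).eval m = place n σ (i.eval m) (k.eval m) (j.eval m) (l.eval m) := by
  simp [pairPlace, WExpr.eval, place, hn, hσ]

theorem fits_pairPlace {m : Store} {W n σ : ℕ} (hn : m.word 0 = n) (hσ : m.word 3 = σ)
    (hW : n * σ * (n * σ) ≤ W) {i k j l : WExpr} (hi : i.Fits W m) (hk : k.Fits W m)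
    (hj : j.Fits W m) (hl : l.Fits W m) (hi' : i.eval m < n) (hk' : k.eval m < σ)
    (hj' : j.eval m < n) (hl' : l.eval m < σ) : (pairPlace i k j l).Fits W m := by
  have h₁ := mul_add_lt_mul hi' hk'
  have h₂ := mul_add_lt_mul hj' hl'
  have h₃ := mul_add_lt_mul h₁ h₂
  have h₄ : n * σ ≤ n * σ * (n * σ) := Nat.le_mul_self _
  have h₅ : n ≤ n * σ := Nat.le_mul_of_pos_right _ (by omega)
  have h₆ : σ ≤ n * σ := Nat.le_mul_of_pos_left _ (by omega)
  simp only [pairPlace, WExpr.Fits, WExpr.eval, hn, hσ, hi, hk, hj, hl, true_and]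
  refine ⟨⟨?_, ?_, ?_⟩, ?_, ?_⟩ <;> omega

/-! ### The estimate of the optimum by Bellman–Ford -/

/-- Compute in real register 3 the largest distance between the points of the vertices in the
word registers 8 and 9. -/
def maxDistProg : Program :=
  .seq (.setReal 3 .zero)
  (.forLoop 10 (.mul (.reg 3) (.reg 3))
    (.ite (.rle (.arr 0 (pairPlace (.reg 8) (.div (.reg 10) (.reg 3)) (.reg 9)
        (.mod (.reg 10) (.reg 3)))) (.reg 3)) .skip
      (.setReal 3 (.arr 0 (pairPlace (.reg 8) (.div (.reg 10) (.reg 3)) (.reg 9)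
        (.mod (.reg 10) (.reg 3)))))))

theorem runs_maxDistProg {W n σ i j : ℕ} {d : ℕ → ℝ} {m : Store} (hn : m.word 0 = n)
    (hσ : m.word 3 = σ) (hi : m.word 8 = i) (hj : m.word 9 = j) (hd : m.realArr 0 = d)
    (hin : i < n) (hjn : j < n) (hW : n * σ * (n * σ) ≤ W) (hσ0 : 0 < σ) :
    Runs W maxDistProg m (100 * (σ * σ)) (fun m' => m'.real 3 = maxDist n σ d i j (σ * σ)) := by
  have hσn : σ ≤ n * σ := Nat.le_mul_of_pos_left _ (by omega)
  have hnn : n ≤ n * σ := Nat.le_mul_of_pos_right _ (by omega)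
  have hsq : n * σ ≤ n * σ * (n * σ) := Nat.le_mul_self _
  have hσσ : σ * σ ≤ n * σ * (n * σ) := Nat.mul_le_mul hσn hσn
  have hσ1 : 1 ≤ σ * σ := Nat.mul_pos hσ0 hσ0
  refine (Runs.seq (R := fun m' => m'.real 3 = 0) (t₁ := 2) (Runs.of_wp
    (by simp [Program.wp, RExpr.Fits, RExpr.eval]) (by decide)) fun m₁ hF₁ h₁ => ?_).mono
    (t₁ := 2 + (σ * σ * (3 + 44 + 8) + (3 + 6))) (by omega) fun _ _ h => h
  refine (Runs.forLoop (fun k m' => m'.real 3 = maxDist n σ d i j k) (σ * σ) 44 rfl (by omega)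
    (fun _ _ _ h => h) ?_ (by simpa [maxDist] using h₁) ?_).mono le_rfl fun _ _ h => h
  · intro m' hF
    simp [WExpr.Fits, WExpr.eval, hF.word 3 rfl, hF₁.word 3 rfl, hσ]
    omega
  · intro y m' hy hF hx hI
    have e0 : m'.word 0 = n := by rw [hF.word 0 rfl, hF₁.word 0 rfl, hn]
    have e3 : m'.word 3 = σ := by rw [hF.word 3 rfl, hF₁.word 3 rfl, hσ]
    have e8 : m'.word 8 = i := by rw [hF.word 8 rfl, hF₁.word 8 rfl, hi]
    have e9 : m'.word 9 = j := by rw [hF.word 9 rfl, hF₁.word 9 rfl, hj]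
    have ed : m'.realArr 0 = d := by rw [hF.realArr 0 rfl, hF₁.realArr 0 rfl, hd]
    have hfit : (pairPlace (.reg 8) (.div (.reg 10) (.reg 3)) (.reg 9)
        (.mod (.reg 10) (.reg 3))).Fits W m' := by
      apply fits_pairPlace e0 e3 hW <;> simp [WExpr.Fits, WExpr.eval, e3, e8, e9, hx, hin, hjn]
      · omega
      · omega
      · omega
      · omega
      · exact Nat.div_lt_of_lt_mul hy
      · exact Nat.mod_lt _ hσ0
    refine Runs.of_wp ?_ (by decide)
    simp only [Program.wp, Test.Fits, RExpr.Fits, Test.Holds, RExpr.eval, hfit,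
      eval_pairPlace e0 e3, WExpr.eval, e3, e8, e9, hx, hI, ed, Function.update_self, maxDist,
      true_and, and_true]
    exact ⟨fun h => (max_eq_left h).symm, fun h => (max_eq_right (not_le.1 h).le).symm⟩

/-- One relaxation: the numbers of the round and of the two vertices are obtained from the word
register 7. -/
def relaxProg : Program :=
  .seq (.seq (.setWord 8 (.mod (.div (.reg 7) (.reg 0)) (.reg 0)))
    (.setWord 9 (.mod (.reg 7) (.reg 0))))
  (.seq maxDistProg
  (.ite (.and (.le (.const 1) (.arr 0 (.add (.mul (.reg 8) (.reg 0)) (.reg 9))))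
      (.and (.le (.const 1) (.arr 2 (.reg 8)))
        (.not (.and (.le (.const 1) (.arr 2 (.reg 9)))
          (.rle (.arr 1 (.reg 9)) (.add (.arr 1 (.reg 8)) (.reg 3)))))))
    (.seq (.setRealArr 1 (.reg 9) (.add (.arr 1 (.reg 8)) (.reg 3)))
      (.setWordArr 2 (.reg 9) (.const 1)))
    .skip))

/-- Compute in real register 4 the length of a shortest path. -/
def shortestProg : Program :=
  .seq (.setWordArr 2 (.reg 2) (.const 1))
  (.seq (.forLoop 7 (.mul (.mul (.reg 0) (.reg 0)) (.reg 0)) relaxProg)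
  (.setReal 4 (.arr 1 (.reg 1))))

section

variable {n : ℕ} {G : SimpleGraph (Fin n)} {A : ℕ → ℕ} {d : ℕ → ℝ} {σ W : ℕ}

theorem runs_relaxProg {m : Store} {t : Fin n} {x : ℕ} (hn : m.word 0 = n) (hσ : m.word 3 = σ)
    (hx : m.word 7 = x) (hxn : x < n * n * n)
    (hAm : m.wordArr 0 = A) (hd : m.realArr 0 = d)
    (hA : ∀ i j : Fin n, A (i * n + j) ≠ 0 ↔ G.Adj i j) (hA1 : ∀ p, A p ≤ 1)
    (hf1 : ∀ p, m.wordArr 2 p ≤ 1)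
    (hr : Relaxed G t (fun i j => maxDist n σ d i j (σ * σ)) (m.wordArr 2) (m.realArr 1) x)
    (hW : n * σ * (n * σ) ≤ W) (hW' : n * n * n ≤ W) (hσ0 : 0 < σ) :
    Runs W relaxProg m (300 * (σ * σ)) (fun m' => (∀ p, m'.wordArr 2 p ≤ 1) ∧
      Relaxed G t (fun i j => maxDist n σ d i j (σ * σ)) (m'.wordArr 2) (m'.realArr 1)
        (x + 1)) := by
  have hnpos : 0 < n := t.pos
  have hnn : n * n ≤ n * n * n := Nat.le_mul_of_pos_right _ hnpos
  have hnle : n ≤ n * n := Nat.le_mul_self n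
  have hσ1 : 1 ≤ σ * σ := Nat.mul_pos hσ0 hσ0
  set i : Fin n := ⟨x / n % n, Nat.mod_lt _ hnpos⟩ with hi
  set j : Fin n := ⟨x % n, Nat.mod_lt _ hnpos⟩ with hj
  -- The program extracts only `i` and `j` from `x`; the round `x / n / n` occurs in the proof
  -- alone.
  have hxij : x = x / n / n * (n * n) + (i * n + j) := by
    have h₁ := Nat.div_add_mod x n
    have h₂ := Nat.div_add_mod (x / n) n
    simp only [hi, hj]
    nth_rewrite 1 [← h₁, ← h₂]
    ring
  have hij := mul_add_lt_mul i.2 j.2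
  refine (Runs.seq (R := fun m' => m'.word 8 = i ∧ m'.word 9 = j) (t₁ := 100)
    (Runs.of_wp ?_ (by decide)) fun m₁ hF₁ h₁ => ?_).mono
    (t₁ := 100 + (100 * (σ * σ) + 100)) (by omega) fun _ _ h => h
  · simp [Program.wp, WExpr.Fits, WExpr.eval, hn, hx, hi, hj]
    omega
  refine Runs.seq (runs_maxDistProg (n := n) (σ := σ) (i := i) (j := j) (d := d)
    ((hF₁.word 0 rfl).trans hn) ((hF₁.word 3 rfl).trans hσ) h₁.1 h₁.2
    ((hF₁.realArr 0 rfl).trans hd) i.2 j.2 hW hσ0) fun m₂ hF₂ h₂ => ?_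
  have e0 : m₂.word 0 = n := by rw [hF₂.word 0 rfl, hF₁.word 0 rfl, hn]
  have e8 : m₂.word 8 = i := by rw [hF₂.word 8 rfl, h₁.1]
  have e9 : m₂.word 9 = j := by rw [hF₂.word 9 rfl, h₁.2]
  have eA : m₂.wordArr 0 = A := by rw [hF₂.wordArr 0 rfl, hF₁.wordArr 0 rfl, hAm]
  have ef : m₂.wordArr 2 = m.wordArr 2 := by rw [hF₂.wordArr 2 rfl, hF₁.wordArr 2 rfl]
  have eb : m₂.realArr 1 = m.realArr 1 := by rw [hF₂.realArr 1 rfl, hF₁.realArr 1 rfl]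
  have hiW : (i : ℕ) ≤ W := by omega
  have hjW : (j : ℕ) ≤ W := by omega
  have h1W : 1 ≤ W := by omega
  have hinW : (i : ℕ) * n ≤ W := by omega
  have hijW : (i : ℕ) * n + j ≤ W := by omega
  have hnW : n ≤ W := by omega
  have hAW : ∀ p, A p ≤ W := fun p => (hA1 p).trans h1W
  have hfW : ∀ p, m.wordArr 2 p ≤ W := fun p => (hf1 p).trans h1W
  refine Runs.of_wp ?_ (by decide)
  simp only [Program.wp, Test.Fits, RExpr.Fits, WExpr.Fits, Test.Holds, RExpr.eval, WExpr.eval,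
    e0, e8, e9, eA, ef, eb, h₂, hiW, hjW, h1W, hinW, hijW, hnW, hAW, hfW, true_and, and_true,
    Nat.one_le_iff_ne_zero, Function.update_self]
  refine ⟨fun ⟨ha, hfi, hb⟩ => ⟨fun p => ?_, hr.relax hxij ((hA i j).1 ha).symm hfi hb⟩,
    fun hneg => ⟨hf1, hr.skip hxij fun ha hfi => ?_⟩⟩
  · rw [Function.update_apply]
    split_ifs
    · exact le_rfl
    · exact hf1 p
  · by_contra hb
    exact hneg ⟨(hA i j).2 ha.symm, hfi, hb⟩

theorem runs_shortestProg {m : Store} {s t : Fin n} {K : ℕ} (hn : m.word 0 = n)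
    (hs : m.word 1 = s) (ht : m.word 2 = t) (hσ : m.word 3 = σ)
    (hAm : m.wordArr 0 = A) (hd : m.realArr 0 = d)
    (hA : ∀ i j : Fin n, A (i * n + j) ≠ 0 ↔ G.Adj i j) (hA1 : ∀ p, A p ≤ 1)
    (hf : m.wordArr 2 = fun _ => 0) (hb : m.realArr 1 = fun _ => 0)
    (hW : n * σ * (n * σ) ≤ W) (hW' : n * n * n ≤ W) (hσ0 : 0 < σ)
    (hK : n * n * n * (σ * σ) ≤ K) :
    Runs W shortestProg m (400 * K) (fun m' => ∃ f b,
      Relaxed G t (fun i j => maxDist n σ d i j (σ * σ)) f b (n * n * n) ∧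
        m'.real 4 = b s) := by
  have hnpos : 0 < n := t.pos
  have hnn : n * n ≤ n * n * n := Nat.le_mul_of_pos_right _ hnpos
  have hnle : n ≤ n * n := Nat.le_mul_self n
  have hσ1 : 1 ≤ σ * σ := Nat.mul_pos hσ0 hσ0
  have hn3 : n * n * n ≤ n * n * n * (σ * σ) := Nat.le_mul_of_pos_right _ hσ1
  refine (Runs.seq (R := fun m' => m'.wordArr 2 = Function.update (fun _ => 0) (t : ℕ) 1)
    (t₁ := 3) (Runs.of_wp ?_ (by decide)) fun m₁ hF₁ h₁ => ?_).mono
    (t₁ := 3 + ((n * n * n * (5 + 300 * (σ * σ) + 8) + (5 + 6)) + 3)) ?_ fun _ _ h => h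
  · have := t.2
    simp [Program.wp, WExpr.Fits, WExpr.eval, ht, hf]
    omega
  · refine Runs.seq (Runs.forLoop (fun x m' => (∀ p, m'.wordArr 2 p ≤ 1) ∧
      Relaxed G t (fun i j => maxDist n σ d i j (σ * σ)) (m'.wordArr 2) (m'.realArr 1) x)
      (n * n * n) (300 * (σ * σ)) rfl hW' (fun _ _ _ h => h) ?_ ?_ ?_) fun m₂ hF₂ h₂ => ?_
    · intro m' hF
      simp [WExpr.Fits, WExpr.eval, hF.word 0 rfl, hF₁.word 0 rfl, hn]
      omega
    · rw [h₁, hF₁.realArr 1 rfl, hb]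
      refine ⟨fun p => ?_, Relaxed.start⟩
      rw [Function.update_apply]
      split_ifs <;> simp
    · rintro x m' hx hF hxm ⟨hI₁, hI₂⟩
      exact runs_relaxProg (by rw [hF.word 0 rfl, hF₁.word 0 rfl, hn])
        (by rw [hF.word 3 rfl, hF₁.word 3 rfl, hσ]) hxm hx
        (by rw [hF.wordArr 0 rfl, hF₁.wordArr 0 rfl, hAm])
        (by rw [hF.realArr 0 rfl, hF₁.realArr 0 rfl, hd]) hA hA1 hI₁ hI₂ hW hW' hσ0
    · refine Runs.of_wp ?_ (by decide)
      have := s.2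
      simp only [Program.wp, RExpr.Fits, WExpr.Fits, RExpr.eval, WExpr.eval, hF₂.word 1 rfl,
        hF₁.word 1 rfl, hs]
      exact ⟨by omega, _, _, h₂.2, by simp⟩
  · have : 1 ≤ n * n * n := by omega
    nlinarith

end

/-! ### Rounding the distance matrix -/

/-- Store in word array 3 the distances, rounded to multiples of the `N`-th part of the real
register 4, where `N` is the content of word register 4. -/
def roundEntryProg : Program :=
  .seq (.setReal 1 .zero)
  (.seq (.forLoop 8 (.reg 4) (.setReal 1 (.add (.reg 1) (.arr 0 (.reg 7)))))
  (.seq (.seq (.setWord 9 (.const 0)) (.setReal 2 (.reg 4)))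
  (.seq (.loop (.and (.le (.reg 9) (.reg 4))
      (.and (.rle (.reg 2) (.reg 1)) (.not (.rle (.reg 1) .zero))))
    (.seq (.setReal 2 (.add (.reg 2) (.reg 4))) (.setWord 9 (.add (.reg 9) (.const 1)))))
  (.setWordArr 3 (.reg 7) (.reg 9)))))

def roundProg : Program :=
  .forLoop 7 (.mul (.mul (.reg 0) (.reg 3)) (.mul (.reg 0) (.reg 3))) roundEntryProg

/-- `N x` is formed by `N` additions, and `k` grows while `(k + 1) D ≤ N x`, up to the cap `N + 1`.
The test `N x > 0` matters when `D = 0`: without it a zero distance would also be driven to the cap.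
-/
theorem runs_roundEntryProg {W N p : ℕ} {D x : ℝ} {m : Store} (hp : m.word 7 = p)
    (hN : m.word 4 = N) (hD : m.real 4 = D) (hx : m.realArr 0 p = x) (hpW : p ≤ W)
    (hW : N + 1 ≤ W) (hx0 : 0 ≤ x) (hD0 : 0 ≤ D) :
    Runs W roundEntryProg m (100 * (N + 1)) (fun m' => ∃ k, Rounded D N x k ∧
      m'.wordArr 3 = Function.update (m.wordArr 3) p k) := by
  refine (Runs.seq (R := fun m' => m'.real 1 = 0) (t₁ := 2) (Runs.of_wp
    (by simp [Program.wp, RExpr.Fits, RExpr.eval]) (by decide)) fun m₁ hF₁ h₁ => ?_).mono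
    (t₁ := 2 + ((N * (1 + 5 + 8) + (1 + 6)) + (10 + (((N + 1) * (12 + 8 + 1) + 13) + 3))))
    (by omega) fun _ _ h => h
  refine Runs.seq (R := fun m' => m'.real 1 = N * x) ((Runs.forLoop
    (fun k m' => m'.real 1 = k * x) N 5 rfl (by omega) (fun _ _ _ h => h)
    ?_ (by simpa using h₁) ?_).mono le_rfl fun _ _ h => h) fun m₂ hF₂ h₂ => ?_
  · intro m' hF
    simp [WExpr.Fits, WExpr.eval, hF.word 4 rfl, hF₁.word 4 rfl, hN]
    omega
  · intro k m' hk hF hxk hI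
    refine Runs.of_wp ?_ (by decide)
    simp [Program.wp, RExpr.Fits, RExpr.eval, WExpr.Fits, WExpr.eval, hI, hF.word 7 rfl,
      hF₁.word 7 rfl, hp, hF.realArr 0 rfl, hF₁.realArr 0 rfl, hx, hpW]
    ring
  refine Runs.seq (R := fun m' => m'.word 9 = 0 ∧ m'.real 2 = D) (t₁ := 10)
    (Runs.of_wp ?_ (by decide)) fun m₃ hF₃ h₃ => ?_
  · simp [Program.wp, RExpr.Fits, RExpr.eval, WExpr.Fits, WExpr.eval, hF₂.real 4 rfl,
      hF₁.real 4 rfl, hD]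
  refine Runs.seq (R := fun m' => ∃ k, Rounded D N x k ∧ m'.word 9 = k) ((Runs.loop
    (fun k m' => m'.word 9 = k ∧ m'.real 2 = (k + 1 : ℕ) * D ∧ D * k ≤ N * x ∧
      (x = 0 → k = 0)) (N + 1) 8 ?_ ?_ ?_).mono le_rfl ?_) fun m₄ hF₄ h₄ => ?_
  · have : 0 ≤ N * x := mul_nonneg (Nat.cast_nonneg _) hx0
    simp [h₃, this]
  · rintro k m' hk hF ⟨h₄, -⟩
    simp only [Test.Fits, RExpr.Fits, WExpr.Fits, h₄, and_true, hF.word 4 rfl, hF₃.word 4 rfl,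
      hF₂.word 4 rfl, hF₁.word 4 rfl, hN]
    omega
  · rintro k m' hk hF ⟨h₄, h₅, h₆, h₇⟩ hb
    simp only [Test.Holds, RExpr.eval, WExpr.eval, h₄, hF.word 4 rfl, hF₃.word 4 rfl,
      hF₂.word 4 rfl, hF₁.word 4 rfl, hN, h₅, hF.real 1 rfl, hF₃.real 1 rfl, h₂] at hb
    obtain ⟨hb₁, hb₂, hb₃⟩ := hb
    refine ⟨by omega, Runs.of_wp ?_ (by decide)⟩
    simp only [Program.wp, RExpr.Fits, RExpr.eval, WExpr.Fits, WExpr.eval, hF.real 4 rfl,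
      hF₃.real 4 rfl, hF₂.real 4 rfl, hF₁.real 4 rfl, hD, h₄, h₅, Function.update_self]
    refine ⟨by simp, by omega, trivial, by push_cast; ring, by push_cast at hb₂ ⊢; linarith,
      fun h0 => absurd ?_ hb₃⟩
    simp [h0]
  · rintro m' hF ⟨k, hk, ⟨h₄, h₅, h₆, h₇⟩, hb⟩
    refine ⟨k, ⟨h₆, fun hkN => ?_, h₇, hk⟩, h₄⟩
    simp only [Test.Holds, RExpr.eval, WExpr.eval, h₄, hF.word 4 rfl, hF₃.word 4 rfl,
      hF₂.word 4 rfl, hF₁.word 4 rfl, hN, h₅, hF.real 1 rfl, hF₃.real 1 rfl, h₂, hkN,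
      true_and] at hb
    by_contra hlt
    rw [not_le] at hlt
    refine hb ⟨by push_cast; linarith, fun h0 => ?_⟩
    have : 0 ≤ D * (k + 1) := by positivity
    linarith
  · obtain ⟨k, hk, h9⟩ := h₄
    refine Runs.of_wp ?_ (by decide)
    have := hk.le
    simp only [Program.wp, WExpr.Fits, WExpr.eval, h9, hF₄.word 7 rfl, hF₃.word 7 rfl,
      hF₂.word 7 rfl, hF₁.word 7 rfl, hp, hF₄.wordArr 3 rfl, hF₃.wordArr 3 rfl,
      hF₂.wordArr 3 rfl, hF₁.wordArr 3 rfl, Function.update_self]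
    exact ⟨hpW, by omega, k, hk, rfl⟩

theorem runs_roundProg {W N n σ K : ℕ} {D : ℝ} {d : ℕ → ℝ} {m : Store} (hn : m.word 0 = n)
    (hσ : m.word 3 = σ) (hN : m.word 4 = N) (hD : m.real 4 = D) (hd : m.realArr 0 = d)
    (hd0 : ∀ p, 0 ≤ d p) (hD0 : 0 ≤ D) (hW : n * σ * (n * σ) ≤ W) (hW' : N + 1 ≤ W)
    (hn0 : 0 < n) (hσ0 : 0 < σ)
    (hK : n * σ * (n * σ) * (N + 1) ≤ K) :
    Runs W roundProg m (200 * K + 20) (fun m' =>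
      ∀ p < n * σ * (n * σ), Rounded D N (d p) (m'.wordArr 3 p)) := by
  unfold roundProg
  refine (Runs.forLoop (fun p m' => ∀ p' < p, Rounded D N (d p') (m'.wordArr 3 p'))
    (n * σ * (n * σ)) (100 * (N + 1)) rfl hW (fun _ _ _ h => h) ?_ (fun _ h => by omega) ?_).mono
    ?_ fun _ _ h => h
  · intro m' hF
    have : n * σ ≤ n * σ * (n * σ) := Nat.le_mul_self _
    simp only [WExpr.Fits, WExpr.eval, hF.word 0 rfl, hF.word 3 rfl, hn, hσ]
    have : n ≤ n * σ := Nat.le_mul_of_pos_right _ hσ0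
    have : σ ≤ n * σ := Nat.le_mul_of_pos_left _ hn0
    refine ⟨⟨⟨?_, ?_, ?_⟩, ⟨?_, ?_, ?_⟩, hW⟩, trivial⟩ <;> omega
  · intro p m' hp hF hpm hI
    refine (runs_roundEntryProg hpm ((hF.word 4 rfl).trans hN) ((hF.real 4 rfl).trans hD)
      (congrFun ((hF.realArr 0 rfl).trans hd) p) (by omega) hW' (hd0 p) hD0).mono le_rfl ?_
    rintro m'' - ⟨k, hk, e⟩ p' hp'
    rw [e]
    rcases Nat.lt_succ_iff_lt_or_eq.1 hp' with hp' | rfl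
    · rw [Function.update_of_ne hp'.ne]
      exact hI p' hp'
    · rwa [Function.update_self]
  · simp only [WExpr.time]
    nlinarith

/-- Compute in word register 5 the number of vectors of values. -/
def powProg : Program :=
  .seq (.setWord 5 (.const 1))
    (.forLoop 7 (.reg 3) (.setWord 5 (.mul (.reg 5) (.add (.reg 4) (.const 1)))))

theorem runs_powProg {W N σ : ℕ} {m : Store} (hσ : m.word 3 = σ) (hN : m.word 4 = N)
    (hW : (N + 1) ^ σ ≤ W) (hW' : N + 1 ≤ W) (hσW : σ ≤ W) :
    Runs W powProg m (20 * (σ + 1)) (fun m' => m'.word 5 = (N + 1) ^ σ) := by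
  refine (Runs.seq (R := fun m' => m'.word 5 = 1) (t₁ := 2) (Runs.of_wp
    (by simp [Program.wp, WExpr.Fits, WExpr.eval]; omega) (by decide)) fun m₁ hF₁ h₁ => ?_).mono
    (t₁ := 2 + (σ * (1 + 6 + 8) + (1 + 6))) (by omega) fun _ _ h => h
  refine Runs.forLoop (fun k m' => m'.word 5 = (N + 1) ^ k) σ 6 rfl hσW
    (fun _ _ _ h => by simpa using h) ?_ (by simpa using h₁) ?_
  · intro m' hF
    simp [WExpr.Fits, WExpr.eval, hF.word 3 rfl, hF₁.word 3 rfl, hσ, hσW]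
  · intro k m' hk hF hxk hI
    refine Runs.of_wp ?_ (by decide)
    have h₂ : (N + 1) ^ (k + 1) ≤ (N + 1) ^ σ := Nat.pow_le_pow_right (by omega) hk
    have h₃ : (N + 1) ^ k ≤ (N + 1) ^ (k + 1) := Nat.pow_le_pow_right (by omega) (by omega)
    simp only [Program.wp, WExpr.Fits, WExpr.eval, hI, hF.word 4 rfl, hF₁.word 4 rfl, hN,
      Function.update_self, ← pow_succ, and_true]
    refine ⟨?_, ⟨?_, ?_, ?_⟩, ?_⟩ <;> omega

/-! ### Extending a state to an adjacent vertex -/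

/-- A digit below `B` plus an entry at most `B`. Overflowing values are thus still representable
before they are rejected, which is where `2 * (N + 1) ≤ W` comes from. -/
theorem stepVal_lt {n σ B : ℕ} {R : ℕ → ℕ} {c i j l K : ℕ} (hB : 0 < B) (hi : i < n) (hj : j < n)
    (hl : l < σ) (hK : K ≤ σ) (hR : ∀ p < n * σ * (n * σ), R p ≤ B) :
    stepVal n σ B R c i j l K < 2 * B := by
  rcases Nat.eq_zero_or_pos K with rfl | h
  · simp only [stepVal]
    omega
  · obtain ⟨k, hk, e⟩ := exists_stepVal_eq (n := n) (σ := σ) (B := B) (R := R) (c := c)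
      (i := i) (j := j) (l := l) h
    have h₁ := Nat.mod_lt (c / B ^ k) hB
    have h₂ := hR _ (place_lt hi (by omega : k < σ) hj hl)
    omega

/-- Compute in word register 17 the value of the point in word register 16 of the vertex in
word register 12, when the state in word register 10 with the vertex in word register 11 is
extended. -/
def valProg : Program :=
  .seq (.seq (.setWord 17 (.const 0)) (.setWord 18 (.const 1)))
  (.forLoop 19 (.reg 3)
    (.seq (.setWord 20 (.add (.mod (.div (.reg 10) (.reg 18)) (.add (.reg 4) (.const 1)))
      (.arr 3 (pairPlace (.reg 11) (.reg 19) (.reg 12) (.reg 16)))))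
    (.seq (.ite (.le (.reg 20) (.reg 17)) .skip (.setWord 17 (.reg 20)))
    (.setWord 18 (.mul (.reg 18) (.add (.reg 4) (.const 1)))))))

theorem runs_valProg {W N n σ c i j l : ℕ} {R : ℕ → ℕ} {m : Store} (hn : m.word 0 = n)
    (hσ : m.word 3 = σ) (hN : m.word 4 = N) (hc : m.word 10 = c) (hi : m.word 11 = i)
    (hj : m.word 12 = j) (hl : m.word 16 = l) (hRm : m.wordArr 3 = R) (hin : i < n) (hjn : j < n)
    (hlσ : l < σ) (hR : ∀ p < n * σ * (n * σ), R p ≤ N + 1)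
    (hcW : c ≤ W) (hVW : (N + 1) ^ σ ≤ W) (hNW : 2 * (N + 1) ≤ W)
    (hW : n * σ * (n * σ) ≤ W) :
    Runs W valProg m (100 * σ) (fun m' => m'.word 17 = stepVal n σ (N + 1) R c i j l σ) := by
  have hσn : σ ≤ n * σ := Nat.le_mul_of_pos_left _ (by omega)
  have hnn : n ≤ n * σ := Nat.le_mul_of_pos_right _ (by omega)
  have hsq : n * σ ≤ n * σ * (n * σ) := Nat.le_mul_self _
  refine (Runs.seq (R := fun m' => m'.word 17 = 0 ∧ m'.word 18 = 1) (t₁ := 4) (Runs.of_wp ?_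
    (by decide)) fun m₁ hF₁ h₁ => ?_).mono
    (t₁ := 4 + (σ * (1 + 48 + 8) + (1 + 6))) (by omega) fun _ _ h => h
  · simp [Program.wp, WExpr.Fits, WExpr.eval]
    omega
  refine (Runs.forLoop (fun k m' => m'.word 17 = stepVal n σ (N + 1) R c i j l k ∧
    m'.word 18 = (N + 1) ^ k) σ 48 rfl (by omega) (fun _ _ _ h => by simpa using h) ?_
    (by simpa [stepVal] using h₁) ?_).mono le_rfl fun _ _ h => h.1
  · intro m' hF
    simp [WExpr.Fits, WExpr.eval, hF.word 3 rfl, hF₁.word 3 rfl, hσ]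
    omega
  · rintro k m' hk hF hxk ⟨hI₁, hI₂⟩
    have e0 : m'.word 0 = n := by rw [hF.word 0 rfl, hF₁.word 0 rfl, hn]
    have e3 : m'.word 3 = σ := by rw [hF.word 3 rfl, hF₁.word 3 rfl, hσ]
    have e4 : m'.word 4 = N := by rw [hF.word 4 rfl, hF₁.word 4 rfl, hN]
    have e10 : m'.word 10 = c := by rw [hF.word 10 rfl, hF₁.word 10 rfl, hc]
    have e11 : m'.word 11 = i := by rw [hF.word 11 rfl, hF₁.word 11 rfl, hi]
    have e12 : m'.word 12 = j := by rw [hF.word 12 rfl, hF₁.word 12 rfl, hj]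
    have e16 : m'.word 16 = l := by rw [hF.word 16 rfl, hF₁.word 16 rfl, hl]
    have eR : m'.wordArr 3 = R := by rw [hF.wordArr 3 rfl, hF₁.wordArr 3 rfl, hRm]
    have hfit : (pairPlace (.reg 11) (.reg 19) (.reg 12) (.reg 16)).Fits W m' := by
      apply fits_pairPlace e0 e3 hW <;>
        simp only [WExpr.Fits, WExpr.eval, e11, e12, e16, hxk, hin, hjn, hk, hlσ] <;> omega
    have h₂ : (N + 1) ^ (k + 1) ≤ (N + 1) ^ σ := Nat.pow_le_pow_right (by omega) hk
    have h₃ : (N + 1) ^ k ≤ (N + 1) ^ (k + 1) := Nat.pow_le_pow_right (by omega) (by omega)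
    have h₄ := hR _ (place_lt hin hk hjn hlσ)
    have h₅ := Nat.mod_lt (c / (N + 1) ^ k) (Nat.add_one_pos N)
    have h₆ := stepVal_lt (c := c) (Nat.add_one_pos N) hin hjn hlσ hk.le hR
    refine Runs.of_wp ?_ (by decide)
    simp [Program.wp, Test.Fits, WExpr.Fits, Test.Holds, WExpr.eval, hfit,
      eval_pairPlace e0 e3, e4, e10, e11, e12, e16, hxk, hI₁, hI₂, eR, stepVal, ← pow_succ]
    refine ⟨by omega, by omega, fun h => ⟨by omega, by omega⟩, fun h => ⟨?_, ?_⟩⟩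
    · omega
    · exact ⟨⟨by omega, by omega, by omega⟩, h.le⟩

theorem isStep_of_val_lt {n σ B c j : ℕ} {A R : ℕ → ℕ} (hB : 0 < B) (hj : j < n)
    (hA : A (c / B ^ σ * n + j) ≠ 0)
    (h : ∀ l < σ, stepVal n σ B R c (c / B ^ σ) j l σ < B) :
    IsStep n σ B A R c (enc (fun l => stepVal n σ B R c (c / B ^ σ) j l σ) B σ + j * B ^ σ) := by
  have e := enc_add_div hB h j
  constructor <;> rw [e] <;> assumption

theorem IsStep.lt_mul {n σ B : ℕ} {A R : ℕ → ℕ} {c c' : ℕ} (hB : 0 < B)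
    (h : IsStep n σ B A R c c') : c' < n * B ^ σ :=
  (Nat.div_lt_iff_lt_mul (pow_pos hB σ)).1 h.lt

/-- The state of the breadth-first search while the `h`-th state of the queue is processed:
the steps to the vertices below `j` have been taken. -/
structure Exploring (M c₀ V : ℕ) (Step : ℕ → ℕ → Prop) (vis q par : ℕ → ℕ) (τ h j : ℕ) : Prop
    extends Search M c₀ Step vis q par τ where
  vis_le : ∀ p, vis p ≤ 1
  head_lt : h < τ
  done : ∀ p < h, ∀ c, Step (q p) c → vis c ≠ 0
  partly : ∀ c, Step (q h) c → c / V < j → vis c ≠ 0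

namespace Exploring

variable {M c₀ V : ℕ} {Step : ℕ → ℕ → Prop} {vis q par : ℕ → ℕ} {τ h j : ℕ}

theorem skip (H : Exploring M c₀ V Step vis q par τ h j)
    (hj : ∀ c, Step (q h) c → c / V = j → vis c ≠ 0) :
    Exploring M c₀ V Step vis q par τ h (j + 1) := by
  refine ⟨H.toSearch, H.vis_le, H.head_lt, H.done, fun c hc hcj => ?_⟩
  rcases Nat.lt_succ_iff_lt_or_eq.1 hcj with hlt | heq
  · exact H.partly c hc hlt
  · exact hj c hc heq

/-- By `hj` a state has at most one successor over the vertex `j`, so a single insertion settles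
`j`. -/
theorem push (H : Exploring M c₀ V Step vis q par τ h j) {c : ℕ} (hs : Step (q h) c)
    (hc : c < M) (hv : vis c = 0) (hj : ∀ c', Step (q h) c' → c' / V = j → c' = c) :
    Exploring M c₀ V Step (Function.update vis c 1) (Function.update q τ c)
      (Function.update par τ h) (τ + 1) h (j + 1) := by
  have hvis : ∀ x, vis x ≠ 0 → Function.update vis c 1 x ≠ 0 := fun x hx => by
    rw [Function.update_apply]
    split_ifs
    · exact one_ne_zero
    · exact hx
  have hq : ∀ p < τ, Function.update q τ c p = q p := fun p hp =>
    Function.update_of_ne hp.ne _ _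
  have hh := H.head_lt
  refine skip ⟨H.toSearch.push hh hs hc hv, fun p => ?_, by omega, fun p hp x hx => ?_,
    fun x hx hlt => ?_⟩ fun x hx heq => ?_
  · rw [Function.update_apply]
    split_ifs
    · exact le_rfl
    · exact H.vis_le p
  · rw [hq p (by omega)] at hx
    exact hvis x (H.done p hp x hx)
  · rw [hq h hh] at hx
    exact hvis x (H.partly x hx hlt)
  · rw [hq h hh] at hx
    simp [hj x hx heq]

end Exploring

/-- Compute in word register 13 the vector of the values of the vertex in word register 12, and
in word register 15 whether they are small enough. -/
def encProg : Program :=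
  .seq (.seq (.setWord 13 (.const 0)) (.seq (.setWord 14 (.const 1)) (.setWord 15 (.const 1))))
  (.forLoop 16 (.reg 3)
    (.seq valProg
    (.seq (.ite (.le (.reg 17) (.reg 4))
        (.setWord 13 (.add (.reg 13) (.mul (.reg 17) (.reg 14))))
        (.setWord 15 (.const 0)))
      (.setWord 14 (.mul (.reg 14) (.add (.reg 4) (.const 1)))))))

/-- Digits that are too large clear the flag in register 15 and are not added. Hence register 13
stays below `(N + 1)^σ` even for a rejected vector, and the address computed from it fits into a
word. -/
theorem runs_encProg {W N n σ c i j : ℕ} {R : ℕ → ℕ} {m : Store} (hn : m.word 0 = n)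
    (hσ : m.word 3 = σ) (hN : m.word 4 = N) (hc : m.word 10 = c) (hi : m.word 11 = i)
    (hj : m.word 12 = j) (hRm : m.wordArr 3 = R) (hin : i < n) (hjn : j < n)
    (hR : ∀ p < n * σ * (n * σ), R p ≤ N + 1) (hσ0 : 0 < σ)
    (hcW : c ≤ W) (hVW : (N + 1) ^ σ ≤ W) (hNW : 2 * (N + 1) ≤ W)
    (hW : n * σ * (n * σ) ≤ W) :
    Runs W encProg m (300 * (σ * σ)) (fun m' => m'.word 15 ≤ 1 ∧ m'.word 13 < (N + 1) ^ σ ∧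
      (m'.word 15 ≠ 0 ↔ ∀ l < σ, stepVal n σ (N + 1) R c i j l σ < N + 1) ∧
      (m'.word 15 ≠ 0 →
        m'.word 13 = enc (fun l => stepVal n σ (N + 1) R c i j l σ) (N + 1) σ)) := by
  have hσn : σ ≤ n * σ := Nat.le_mul_of_pos_left _ (by omega)
  have hsq : n * σ ≤ n * σ * (n * σ) := Nat.le_mul_self _
  have hσ1 : σ ≤ σ * σ := Nat.le_mul_self _
  refine (Runs.seq (R := fun m' => m'.word 13 = 0 ∧ m'.word 14 = 1 ∧ m'.word 15 = 1) (t₁ := 6)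
    (Runs.of_wp ?_ (by decide)) fun m₁ hF₁ h₁ => ?_).mono
    (t₁ := 6 + (σ * (1 + (100 * σ + 20) + 8) + (1 + 6))) (by nlinarith) fun _ _ h => h
  · simp [Program.wp, WExpr.Fits, WExpr.eval]
    omega
  refine (Runs.forLoop (fun l m' => m'.word 14 = (N + 1) ^ l ∧ m'.word 15 ≤ 1 ∧
      m'.word 13 < (N + 1) ^ l ∧
      (m'.word 15 ≠ 0 ↔ ∀ l' < l, stepVal n σ (N + 1) R c i j l' σ < N + 1) ∧
      (m'.word 15 ≠ 0 →
        m'.word 13 = enc (fun l => stepVal n σ (N + 1) R c i j l σ) (N + 1) l)) σ (100 * σ + 20)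
    rfl (by omega) (fun _ _ _ h => by simpa using h) ?_ (by simp [h₁, enc]) ?_).mono le_rfl
    fun _ _ h => h.2
  · intro m' hF
    simp [WExpr.Fits, WExpr.eval, hF.word 3 rfl, hF₁.word 3 rfl, hσ]
    omega
  · rintro l m' hl hF hxl ⟨hI₁, hI₂, hI₃, hI₄, hI₅⟩
    have e4 : m'.word 4 = N := by rw [hF.word 4 rfl, hF₁.word 4 rfl, hN]
    refine Runs.seq (runs_valProg (by rw [hF.word 0 rfl, hF₁.word 0 rfl, hn])
      (by rw [hF.word 3 rfl, hF₁.word 3 rfl, hσ]) e4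
      (by rw [hF.word 10 rfl, hF₁.word 10 rfl, hc]) (by rw [hF.word 11 rfl, hF₁.word 11 rfl, hi])
      (by rw [hF.word 12 rfl, hF₁.word 12 rfl, hj]) hxl
      (by rw [hF.wordArr 3 rfl, hF₁.wordArr 3 rfl, hRm]) hin hjn hl hR hcW hVW hNW hW)
      fun m₂ hF₂ h₂ => ?_
    have h₃ : (N + 1) ^ (l + 1) ≤ (N + 1) ^ σ := Nat.pow_le_pow_right (by omega) hl
    have h₄ : (N + 1) ^ l ≤ (N + 1) ^ (l + 1) := Nat.pow_le_pow_right (by omega) (by omega)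
    have h₆ := stepVal_lt (c := c) (Nat.add_one_pos N) hin hjn hl le_rfl hR
    rw [← hF₂.word 14 rfl] at hI₁
    rw [← hF₂.word 15 rfl] at hI₂ hI₄ hI₅
    rw [← hF₂.word 13 rfl] at hI₃ hI₅
    rw [← hF₂.word 4 rfl] at e4
    set v := stepVal n σ (N + 1) R c i j l σ with hv
    have hlast : (∀ l' < l + 1, stepVal n σ (N + 1) R c i j l' σ < N + 1) ↔
        (∀ l' < l, stepVal n σ (N + 1) R c i j l' σ < N + 1) ∧ v ≤ N := by
      constructor
      · exact fun h => ⟨fun l' hl' => h l' (by omega), Nat.lt_succ_iff.1 (h l (by omega))⟩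
      · rintro ⟨h, h'⟩ l' hl'
        rcases Nat.lt_succ_iff_lt_or_eq.1 hl' with hlt | rfl
        · exact h l' hlt
        · exact Nat.lt_succ_iff.2 h'
    refine Runs.of_wp ?_ (by decide)
    simp [Program.wp, Test.Fits, WExpr.Fits, Test.Holds, WExpr.eval, e4, hI₁, h₂, enc, ← pow_succ,
      -Order.lt_add_one_iff, -Order.add_one_le_iff, hlast]
    have hval : stepVal n σ (N + 1) R c i j l σ = v := rfl
    refine ⟨by omega, fun hvN => ?_, fun hvN => ⟨by omega, by omega, fun _ => hvN⟩⟩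
    have h₇ := mul_add_lt_mul (Nat.lt_succ_iff.2 hvN) hI₃
    rw [Nat.succ_eq_add_one, ← pow_succ'] at h₇
    refine ⟨by omega, by omega, hI₂, by omega, ?_, fun h15 => ?_⟩
    · rw [← ne_eq, hI₄]
      simp [hvN]
    · rw [hI₅ h15, hval]

/-- Extend the state in word register 10 to the vertex in word register 12 and append the result
to the queue. -/
def pushProg : Program :=
  .seq encProg
  (.seq (.setWord 13 (.add (.reg 13) (.mul (.reg 12) (.reg 5))))
  (.ite (.and (.le (.const 1) (.reg 15)) (.le (.arr 4 (.reg 13)) (.const 0)))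
    (.seq (.seq (.setWordArr 4 (.reg 13) (.const 1)) (.setWordArr 5 (.reg 9) (.reg 13)))
    (.seq (.setWordArr 6 (.reg 9) (.reg 8)) (.setWord 9 (.add (.reg 9) (.const 1)))))
    .skip))

theorem runs_pushProg {W N n σ c₀ h τ j : ℕ} {A R q : ℕ → ℕ} {m : Store} (hn : m.word 0 = n)
    (hσ : m.word 3 = σ) (hN : m.word 4 = N) (hV : m.word 5 = (N + 1) ^ σ)
    (h8 : m.word 8 = h) (h9 : m.word 9 = τ)
    (hc : m.word 10 = q h) (hi : m.word 11 = q h / (N + 1) ^ σ)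
    (hj : m.word 12 = j) (hRm : m.wordArr 3 = R) (hq : m.wordArr 5 = q) (hjn : j < n)
    (hR : ∀ p < n * σ * (n * σ), R p ≤ N + 1) (hσ0 : 0 < σ)
    (hadj : A (q h / (N + 1) ^ σ * n + j) ≠ 0)
    (hE : Exploring (n * (N + 1) ^ σ) c₀ ((N + 1) ^ σ) (IsStep n σ (N + 1) A R) (m.wordArr 4) q
      (m.wordArr 6) τ h j)
    (hMW : n * (N + 1) ^ σ ≤ W) (hNW : 2 * (N + 1) ≤ W) (hW : n * σ * (n * σ) ≤ W) :
    Runs W pushProg m (400 * (σ * σ)) (fun m' =>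
      Exploring (n * (N + 1) ^ σ) c₀ ((N + 1) ^ σ) (IsStep n σ (N + 1) A R) (m'.wordArr 4)
        (m'.wordArr 5) (m'.wordArr 6) (m'.word 9) h (j + 1) ∧ m'.wordArr 5 h = q h) := by
  have hσ1 : 1 ≤ σ * σ := Nat.mul_pos hσ0 hσ0
  have hVpos : 0 < (N + 1) ^ σ := pow_pos (Nat.add_one_pos N) σ
  have hVM : (N + 1) ^ σ ≤ n * (N + 1) ^ σ := Nat.le_mul_of_pos_left _ (by omega)
  have hnM : n ≤ n * (N + 1) ^ σ := Nat.le_mul_of_pos_right _ hVpos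
  have hcM := hE.lt h hE.head_lt
  have hin : q h / (N + 1) ^ σ < n := (Nat.div_lt_iff_lt_mul hVpos).2 hcM
  have hh := hE.head_lt
  have hτ := hE.le
  refine (Runs.seq (runs_encProg hn hσ hN hc hi hj hRm hin hjn hR hσ0 (by omega) (by omega) hNW hW)
    fun m₁ hF₁ ⟨h₁, h₂, h₃, h₄⟩ => ?_).mono (t₁ := 300 * (σ * σ) + 60) (by omega) fun _ _ h => h
  have hnew := mul_add_lt_mul hjn h₂
  have hvisW : ∀ p, m.wordArr 4 p ≤ W := fun p => (hE.vis_le p).trans (by omega)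
  refine Runs.of_wp ?_ (by decide)
  simp only [Program.wp, Test.Fits, WExpr.Fits, Test.Holds, WExpr.eval, Function.update_self,
    Function.update_of_ne, ne_eq, not_false_eq_true,
    Nat.reduceEqDiff, hF₁.word 5 rfl, hF₁.word 8 rfl, hF₁.word 9 rfl, hF₁.word 12 rfl,
    hF₁.wordArr 4 rfl, hF₁.wordArr 5 rfl, hF₁.wordArr 6 rfl, hV, h8, h9, hj, hq, hvisW]
  refine ⟨by omega, ⟨by omega, ⟨by omega, trivial⟩, by omega⟩, fun ⟨h₅, h₆⟩ => ?_, fun hneg => ?_⟩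
  · have h15 : m₁.word 15 ≠ 0 := by omega
    have hs := isStep_of_val_lt (Nat.add_one_pos N) hjn hadj (h₃.1 h15)
    rw [← h₄ h15] at hs
    have hpush := hE.push hs (hs.lt_mul (Nat.add_one_pos N)) (by omega) fun c' hc' e => by
      rw [h₄ h15, hc'.eq, e]
    have hle := hpush.le
    refine ⟨by omega, by omega, by omega, by omega, by omega, by omega, by omega, hpush, ?_⟩
    exact Function.update_of_ne hh.ne _ _
  -- Nothing is inserted: either a value overflows and there is no step to `j`, or the only possible
  -- successor is already marked.
  · refine ⟨hE.skip fun c' hc' e => ?_, trivial⟩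
    have h15 : m₁.word 15 ≠ 0 := h₃.2 fun l hl => e ▸ hc'.val_lt l hl
    intro hv
    refine hneg ⟨by omega, ?_⟩
    rw [h₄ h15]
    rw [hc'.eq, e] at hv
    exact hv.le

theorem Exploring.next {M c₀ V : ℕ} {Step : ℕ → ℕ → Prop} {vis q par : ℕ → ℕ} {τ h n : ℕ}
    (H : Exploring M c₀ V Step vis q par τ h n) (hn : ∀ c c', Step c c' → c' / V < n) {p : ℕ}
    (hp : p < h + 1) {c : ℕ} (hc : Step (q p) c) : vis c ≠ 0 := by
  rcases Nat.lt_succ_iff_lt_or_eq.1 hp with hlt | rfl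
  · exact H.done p hlt c hc
  · exact H.partly c hc (hn _ _ hc)

/-! ### The breadth-first search over all states -/

/-- Process the state at the head of the queue. -/
def expandProg : Program :=
  .seq (.seq (.setWord 10 (.arr 5 (.reg 8))) (.setWord 11 (.div (.reg 10) (.reg 5))))
  (.seq (.forLoop 12 (.reg 0)
    (.ite (.le (.const 1) (.arr 0 (.add (.mul (.reg 11) (.reg 0)) (.reg 12)))) pushProg .skip))
  (.setWord 8 (.add (.reg 8) (.const 1))))

/-- Breadth-first search in the graph of states. -/
def searchProg : Program :=
  .seq (.seq (.seq (.setWord 8 (.const 0)) (.setWord 9 (.const 1)))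
    (.seq (.setWordArr 5 (.const 0) (.mul (.reg 2) (.reg 5)))
      (.setWordArr 4 (.mul (.reg 2) (.reg 5)) (.const 1))))
  (.loop (.lt (.reg 8) (.reg 9)) expandProg)

theorem runs_expandProg {W N n σ c₀ h : ℕ} {A R : ℕ → ℕ} {m : Store} (hn : m.word 0 = n)
    (hσ : m.word 3 = σ) (hN : m.word 4 = N) (hV : m.word 5 = (N + 1) ^ σ) (h8 : m.word 8 = h)
    (hh : h < m.word 9) (hAm : m.wordArr 0 = A) (hRm : m.wordArr 3 = R)
    (hA1 : ∀ p, A p ≤ 1) (hR : ∀ p < n * σ * (n * σ), R p ≤ N + 1) (hσ0 : 0 < σ)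
    (hS : Search (n * (N + 1) ^ σ) c₀ (IsStep n σ (N + 1) A R) (m.wordArr 4) (m.wordArr 5)
      (m.wordArr 6) (m.word 9)) (hvis : ∀ p, m.wordArr 4 p ≤ 1)
    (hdone : ∀ p < h, ∀ c, IsStep n σ (N + 1) A R (m.wordArr 5 p) c → m.wordArr 4 c ≠ 0)
    (hnW : n * n ≤ W) (hMW : n * (N + 1) ^ σ ≤ W) (hNW : 2 * (N + 1) ≤ W)
    (hW : n * σ * (n * σ) ≤ W) :
    Runs W expandProg m (500 * (n * (σ * σ))) (fun m' => m'.word 8 = h + 1 ∧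
      Search (n * (N + 1) ^ σ) c₀ (IsStep n σ (N + 1) A R) (m'.wordArr 4) (m'.wordArr 5)
        (m'.wordArr 6) (m'.word 9) ∧ (∀ p, m'.wordArr 4 p ≤ 1) ∧
      (∀ p < h + 1, ∀ c, IsStep n σ (N + 1) A R (m'.wordArr 5 p) c → m'.wordArr 4 c ≠ 0)
      ∧ h + 1 ≤ m'.word 9) := by
  have hσ1 : 1 ≤ σ * σ := Nat.mul_pos hσ0 hσ0
  have hVpos : 0 < (N + 1) ^ σ := pow_pos (Nat.add_one_pos N) σ
  have hcM := hS.lt h hh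
  have hn0 : 0 < n := by
    rcases Nat.eq_zero_or_pos n with rfl | hpos
    · simp at hcM
    · exact hpos
  have hVM : (N + 1) ^ σ ≤ n * (N + 1) ^ σ := Nat.le_mul_of_pos_left _ hn0
  have hnM : n ≤ n * (N + 1) ^ σ := Nat.le_mul_of_pos_right _ hVpos
  set c := m.wordArr 5 h with hc
  have hin : c / (N + 1) ^ σ < n := (Nat.div_lt_iff_lt_mul hVpos).2 hcM
  have hτ := hS.le
  refine (Runs.seq (R := fun m' => m'.word 10 = c ∧ m'.word 11 = c / (N + 1) ^ σ) (t₁ := 10)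
    (Runs.of_wp ?_ (by decide)) fun m₁ hF₁ h₁ => ?_).mono
    (t₁ := 10 + ((n * (1 + (8 + 400 * (σ * σ) + 1) + 8) + (1 + 6)) + 4))
    (by nlinarith [Nat.mul_le_mul hn0 hσ1]) fun _ _ h => h
  · simp [Program.wp, WExpr.Fits, WExpr.eval, h8, ← hc, hV]
    omega
  -- Insertions happen at the end of the queue, beyond `h`, so the head state `c` remains in place.
  refine Runs.seq (Runs.forLoop (fun j m' => Exploring (n * (N + 1) ^ σ) c₀ ((N + 1) ^ σ)
      (IsStep n σ (N + 1) A R) (m'.wordArr 4) (m'.wordArr 5) (m'.wordArr 6) (m'.word 9) h j ∧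
      m'.wordArr 5 h = c) n (8 + 400 * (σ * σ) + 1)
    rfl (by omega) (fun _ _ _ h => by simpa using h) ?_ ?_ ?_) fun m₂ hF₂ ⟨h₂, h₃⟩ => ?_
  · intro m' hF
    simp [WExpr.Fits, WExpr.eval, hF.word 0 rfl, hF₁.word 0 rfl, hn]
    omega
  · simp only [hF₁.wordArr 4 rfl, hF₁.wordArr 5 rfl, hF₁.wordArr 6 rfl, hF₁.word 9 rfl]
    exact ⟨⟨hS, hvis, hh, hdone, fun c _ hlt => absurd hlt (Nat.not_lt_zero _)⟩, hc.symm⟩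
  · rintro j m' hj hF hxj ⟨hE, hq⟩
    have e0 : m'.word 0 = n := by rw [hF.word 0 rfl, hF₁.word 0 rfl, hn]
    have e11 : m'.word 11 = c / (N + 1) ^ σ := by rw [hF.word 11 rfl, h₁.2]
    have eA : m'.wordArr 0 = A := by rw [hF.wordArr 0 rfl, hF₁.wordArr 0 rfl, hAm]
    have hlt := mul_add_lt_mul hin hj
    have hA1' : A (c / (N + 1) ^ σ * n + j) ≤ W := (hA1 _).trans (by omega)
    refine Runs.ite ?_ (fun hb => ?_) (fun hb => ?_)
    · simp only [Test.Fits, WExpr.Fits, WExpr.eval, e0, e11, eA, hxj, hA1']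
      refine ⟨by omega, ⟨⟨?_, ?_, ?_⟩, ?_, ?_⟩, trivial⟩ <;> omega
    · simp only [Test.Holds, WExpr.eval, e0, e11, eA, hxj] at hb
      refine (runs_pushProg (q := m'.wordArr 5) e0 (by rw [hF.word 3 rfl, hF₁.word 3 rfl, hσ])
        (by rw [hF.word 4 rfl, hF₁.word 4 rfl, hN]) (by rw [hF.word 5 rfl, hF₁.word 5 rfl, hV])
        (by rw [hF.word 8 rfl, hF₁.word 8 rfl, h8]) rfl
        (by rw [hF.word 10 rfl, h₁.1, hq]) (by rw [e11, hq]) hxj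
        (by rw [hF.wordArr 3 rfl, hF₁.wordArr 3 rfl, hRm]) rfl hj hR hσ0
        (by rw [hq]; omega) hE hMW hNW hW).mono (by omega) ?_
      exact fun _ _ h => ⟨h.1, h.2.trans hq⟩
    · simp only [Test.Holds, WExpr.eval, e0, e11, eA, hxj] at hb
      refine Runs.of_wp ⟨hE.skip fun c' hc' e => ?_, hq⟩ (by simp [Program.straightTime]; omega)
      rw [hq] at hc'
      exact absurd hc'.adj (by rw [e]; omega)
  · have hh₂ := h₂.head_lt
    have hle := h₂.le
    refine Runs.of_wp ?_ (by decide)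
    simp only [Program.wp, WExpr.Fits, WExpr.eval, hF₂.word 8 rfl, hF₁.word 8 rfl, h8,
      Function.update_self]
    refine ⟨by omega, trivial, h₂.toSearch, h₂.vis_le, fun p hp c hc => ?_, ?_⟩
    · exact h₂.next (fun _ _ h => h.lt) hp hc
    · exact hh₂

theorem runs_searchProg {W N n σ : ℕ} {t : Fin n} {A R : ℕ → ℕ} {m : Store} (hn : m.word 0 = n)
    (ht : m.word 2 = t)
    (hσ : m.word 3 = σ) (hN : m.word 4 = N) (hV : m.word 5 = (N + 1) ^ σ)
    (hAm : m.wordArr 0 = A) (hRm : m.wordArr 3 = R) (hvis : m.wordArr 4 = fun _ => 0)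
    (hA1 : ∀ p, A p ≤ 1) (hR : ∀ p < n * σ * (n * σ), R p ≤ N + 1) (hσ0 : 0 < σ)
    (hnW : n * n ≤ W) (hMW : n * (N + 1) ^ σ ≤ W) (hNW : 2 * (N + 1) ≤ W)
    (hW : n * σ * (n * σ) ≤ W) :
    Runs W searchProg m (600 * (n * (N + 1) ^ σ * (n * (σ * σ)))) (fun m' =>
      Search (n * (N + 1) ^ σ) (t * (N + 1) ^ σ) (IsStep n σ (N + 1) A R) (m'.wordArr 4)
        (m'.wordArr 5) (m'.wordArr 6) (m'.word 9) ∧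
      ∀ p < m'.word 9, ∀ c, IsStep n σ (N + 1) A R (m'.wordArr 5 p) c → m'.wordArr 4 c ≠ 0) := by
  have hσ1 : 1 ≤ σ * σ := Nat.mul_pos hσ0 hσ0
  have hVpos : 0 < (N + 1) ^ σ := pow_pos (Nat.add_one_pos N) σ
  have hn0 : 0 < n := t.pos
  have hVM : (N + 1) ^ σ ≤ n * (N + 1) ^ σ := Nat.le_mul_of_pos_left _ hn0
  have hnM : n ≤ n * (N + 1) ^ σ := Nat.le_mul_of_pos_right _ hVpos
  have hM0 : 1 ≤ n * (N + 1) ^ σ := by omega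
  have htM : t * (N + 1) ^ σ < n * (N + 1) ^ σ := Nat.mul_lt_mul_of_pos_right t.2 hVpos
  have h1 : 1 ≤ n * (σ * σ) := Nat.mul_pos hn0 hσ1
  refine (Runs.seq (R := fun m' => m'.word 8 = 0 ∧ m'.word 9 = 1 ∧
    m'.wordArr 5 = Function.update (m.wordArr 5) 0 (t * (N + 1) ^ σ) ∧
    m'.wordArr 4 = Function.update (fun _ => 0) (t * (N + 1) ^ σ) 1) (t₁ := 20)
    (Runs.of_wp ?_ (by decide)) fun m₁ hF₁ ⟨h₁, h₂, h₃, h₄⟩ => ?_).mono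
    (t₁ := 20 + (n * (N + 1) ^ σ * (4 + 500 * (n * (σ * σ)) + 1) + (4 + 1)))
    (by nlinarith [Nat.mul_le_mul hM0 h1, Nat.mul_le_mul_left (n * (N + 1) ^ σ) h1])
    fun _ _ h => h
  · have := t.2
    simp [Program.wp, WExpr.Fits, WExpr.eval, ht, hV, hvis]
    omega
  -- The head lies before the end of the queue at each expansion, and `Search.le` bounds that end by
  -- the number of states.
  refine (Runs.loop (fun h m' => m'.word 8 = h ∧
      Search (n * (N + 1) ^ σ) (t * (N + 1) ^ σ) (IsStep n σ (N + 1) A R) (m'.wordArr 4)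
        (m'.wordArr 5) (m'.wordArr 6) (m'.word 9) ∧ (∀ p, m'.wordArr 4 p ≤ 1) ∧
      (∀ p < h, ∀ c, IsStep n σ (N + 1) A R (m'.wordArr 5 p) c → m'.wordArr 4 c ≠ 0) ∧
      h ≤ m'.word 9) (n * (N + 1) ^ σ) (500 * (n * (σ * σ))) ?_ ?_ ?_).mono le_rfl ?_
  · refine ⟨h₁, ?_, fun p => ?_, fun p hp => by omega, by omega⟩
    · rw [h₂, h₃, h₄]
      exact Search.start htM
    · rw [h₄, Function.update_apply]
      split_ifs <;> simp
  · rintro h m' hh hF ⟨h₅, h₆, -, -, h₇⟩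
    have := h₆.le
    simp only [Test.lt, Test.Fits, WExpr.Fits, h₅]
    omega
  · rintro h m' hh hF ⟨h₅, h₆, h₇, h₈, h₉⟩ hb
    have hlt : h < m'.word 9 := by simpa [Test.lt, Test.Holds, WExpr.eval, h₅] using hb
    have := h₆.le
    refine ⟨by omega, runs_expandProg (by rw [hF.word 0 rfl, hF₁.word 0 rfl, hn])
      (by rw [hF.word 3 rfl, hF₁.word 3 rfl, hσ]) (by rw [hF.word 4 rfl, hF₁.word 4 rfl, hN])
      (by rw [hF.word 5 rfl, hF₁.word 5 rfl, hV]) h₅ hlt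
      (by rw [hF.wordArr 0 rfl, hF₁.wordArr 0 rfl, hAm])
      (by rw [hF.wordArr 3 rfl, hF₁.wordArr 3 rfl, hRm]) hA1 hR hσ0 h₆ h₇ h₈ hnW hMW hNW hW⟩
  · rintro m' hF ⟨h, hh, ⟨h₅, h₆, h₇, h₈, h₉⟩, hb⟩
    have hle : m'.word 9 ≤ h := by simpa [Test.lt, Test.Holds, WExpr.eval, h₅] using hb
    exact ⟨h₆, fun p hp => h₈ p (by omega)⟩

/-! ### Selecting the best state at the origin -/

/-- Compute in word register 11 the largest value of the state in word register 10. -/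
def maxValProg : Program :=
  .seq (.seq (.setWord 11 (.const 0)) (.setWord 12 (.const 1)))
  (.forLoop 13 (.reg 3)
    (.seq (.setWord 14 (.mod (.div (.reg 10) (.reg 12)) (.add (.reg 4) (.const 1))))
    (.seq (.ite (.le (.reg 14) (.reg 11)) .skip (.setWord 11 (.reg 14)))
    (.setWord 12 (.mul (.reg 12) (.add (.reg 4) (.const 1)))))))

/-- Store in word register 6 the place in the queue of the best state at the vertex `s`. -/
def bestProg : Program :=
  .seq (.seq (.setWord 6 (.const 0)) (.setWord 7 (.add (.reg 4) (.const 1))))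
  (.forLoop 8 (.reg 9)
    (.seq (.setWord 10 (.arr 5 (.reg 8)))
    (.seq maxValProg
    (.ite (.and (.and (.le (.div (.reg 10) (.reg 5)) (.reg 1))
        (.le (.reg 1) (.div (.reg 10) (.reg 5)))) (.lt (.reg 11) (.reg 7)))
      (.seq (.setWord 7 (.reg 11)) (.setWord 6 (.reg 8))) .skip))))

theorem maxVal_lt {B c K : ℕ} (hB : 0 < B) : maxVal B c K < B := by
  rcases Nat.eq_zero_or_pos K with rfl | h
  · exact hB
  · obtain ⟨k, -, e⟩ := exists_maxVal_eq (B := B) (c := c) h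
    exact e ▸ Nat.mod_lt _ hB

theorem runs_maxValProg {W N σ c : ℕ} {m : Store} (hσ : m.word 3 = σ) (hN : m.word 4 = N)
    (hc : m.word 10 = c) (hσ0 : 0 < σ) (hσW : σ ≤ W) (hcW : c ≤ W) (hVW : (N + 1) ^ σ ≤ W)
    (hNW : 2 * (N + 1) ≤ W) :
    Runs W maxValProg m (100 * σ) (fun m' => m'.word 11 = maxVal (N + 1) c σ) := by
  refine (Runs.seq (R := fun m' => m'.word 11 = 0 ∧ m'.word 12 = 1) (t₁ := 4) (Runs.of_wp ?_
    (by decide)) fun m₁ hF₁ h₁ => ?_).mono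
    (t₁ := 4 + (σ * (1 + 48 + 8) + (1 + 6))) (by omega) fun _ _ h => h
  · simp [Program.wp, WExpr.Fits, WExpr.eval]
    omega
  refine (Runs.forLoop (fun k m' => m'.word 11 = maxVal (N + 1) c k ∧
    m'.word 12 = (N + 1) ^ k) σ 48 rfl (by omega) (fun _ _ _ h => by simpa using h) ?_
    (by simpa [maxVal] using h₁) ?_).mono le_rfl fun _ _ h => h.1
  · intro m' hF
    simp [WExpr.Fits, WExpr.eval, hF.word 3 rfl, hF₁.word 3 rfl, hσ]
    omega
  · rintro k m' hk hF hxk ⟨hI₁, hI₂⟩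
    have e4 : m'.word 4 = N := by rw [hF.word 4 rfl, hF₁.word 4 rfl, hN]
    have e10 : m'.word 10 = c := by rw [hF.word 10 rfl, hF₁.word 10 rfl, hc]
    have h₂ : (N + 1) ^ (k + 1) ≤ (N + 1) ^ σ := Nat.pow_le_pow_right (by omega) hk
    have h₃ : (N + 1) ^ k ≤ (N + 1) ^ (k + 1) := Nat.pow_le_pow_right (by omega) (by omega)
    have h₅ := Nat.mod_lt (c / (N + 1) ^ k) (Nat.add_one_pos N)
    have h₆ := maxVal_lt (c := c) (K := k) (Nat.add_one_pos N)
    refine Runs.of_wp ?_ (by decide)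
    simp [Program.wp, Test.Fits, WExpr.Fits, Test.Holds, WExpr.eval, e4, e10, hI₁, hI₂, maxVal,
      ← pow_succ]
    refine ⟨by omega, by omega, fun h => ⟨by omega, by omega⟩, fun h => ⟨?_, ?_⟩⟩
    · omega
    · exact ⟨⟨by omega, by omega, by omega⟩, h.le⟩

theorem runs_bestProg {W N σ V s τ : ℕ} {q : ℕ → ℕ} {m : Store} (hs : m.word 1 = s)
    (hσ : m.word 3 = σ) (hN : m.word 4 = N) (hV : m.word 5 = V) (hτ : m.word 9 = τ)
    (hq : m.wordArr 5 = q) (hσ0 : 0 < σ) (hσW : σ ≤ W) (hqW : ∀ p < τ, q p ≤ W) (hτW : τ ≤ W)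
    (hVW : (N + 1) ^ σ ≤ W) (hV' : V ≤ W) (hsW : s ≤ W) (hNW : 2 * (N + 1) ≤ W) :
    Runs W bestProg m (200 * (τ * σ) + 20) (fun m' =>
      ∀ p < τ, q p / V = s → m'.word 6 < τ ∧ q (m'.word 6) / V = s ∧
        maxVal (N + 1) (q (m'.word 6)) σ ≤ maxVal (N + 1) (q p) σ) := by
  refine (Runs.seq (R := fun m' => m'.word 6 = 0 ∧ m'.word 7 = N + 1) (t₁ := 6) (Runs.of_wp ?_
    (by decide)) fun m₁ hF₁ h₁ => ?_).mono
    (t₁ := 6 + (τ * (1 + (3 + (100 * σ + 60)) + 8) + (1 + 6))) (by nlinarith) fun _ _ h => h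
  · simp [Program.wp, WExpr.Fits, WExpr.eval, hN]
    omega
  -- The initial value `N + 1` of register 7 exceeds every maximum and means that no state at `s`
  -- has been seen.
  refine (Runs.forLoop (fun x m' => m'.word 7 ≤ N + 1 ∧
    (m'.word 7 ≠ N + 1 → m'.word 6 < x ∧ q (m'.word 6) / V = s ∧
      m'.word 7 = maxVal (N + 1) (q (m'.word 6)) σ) ∧
    ∀ p < x, q p / V = s → m'.word 7 ≤ maxVal (N + 1) (q p) σ) τ (3 + (100 * σ + 60)) rfl hτW
    (fun _ _ _ h => by simpa using h) ?_ (by simp [h₁]) ?_).mono le_rfl ?_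
  · intro m' hF
    simp [WExpr.Fits, WExpr.eval, hF.word 9 rfl, hF₁.word 9 rfl, hτ]
    omega
  · rintro x m' hx hF hxm ⟨hI₁, hI₂, hI₃⟩
    refine Runs.seq (R := fun m' => m'.word 10 = q x) (t₁ := 3) (Runs.of_wp ?_ (by decide))
      fun m₂ hF₂ h₂ => ?_
    · have := hqW x hx
      simp [Program.wp, WExpr.Fits, WExpr.eval, hxm, hF.wordArr 5 rfl, hF₁.wordArr 5 rfl, hq]
      omega
    refine Runs.seq (runs_maxValProg
      (by rw [hF₂.word 3 rfl, hF.word 3 rfl, hF₁.word 3 rfl, hσ])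
      (by rw [hF₂.word 4 rfl, hF.word 4 rfl, hF₁.word 4 rfl, hN]) h₂ hσ0 hσW (hqW x hx) hVW hNW)
      fun m₃ hF₃ h₃ => ?_
    have h₄ := maxVal_lt (c := q x) (K := σ) (Nat.add_one_pos N)
    have h₅ := hqW x hx
    rw [← hF₂.word 6 rfl, ← hF₃.word 6 rfl] at hI₂
    rw [← hF₂.word 7 rfl, ← hF₃.word 7 rfl] at hI₁ hI₂ hI₃
    have e1 : m₃.word 1 = s := by rw [hF₃.word 1 rfl, hF₂.word 1 rfl, hF.word 1 rfl,
      hF₁.word 1 rfl, hs]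
    have e5 : m₃.word 5 = V := by rw [hF₃.word 5 rfl, hF₂.word 5 rfl, hF.word 5 rfl,
      hF₁.word 5 rfl, hV]
    have e8 : m₃.word 8 = x := by rw [hF₃.word 8 rfl, hF₂.word 8 rfl, hxm]
    have e10 : m₃.word 10 = q x := by rw [hF₃.word 10 rfl, h₂]
    refine Runs.of_wp ?_ (by decide)
    simp [Program.wp, Test.lt, Test.Fits, WExpr.Fits, Test.Holds, WExpr.eval, e1, e5, e8, e10, h₃,
      -Order.lt_add_one_iff, -Order.add_one_le_iff]
    refine ⟨by omega, fun h₆ h₇ h₈ => ?_, fun hneg => ?_⟩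
    · refine ⟨by omega, by omega, by omega, fun _ => le_antisymm h₆ h₇,
        fun p hp hps => ?_⟩
      rcases Nat.lt_succ_iff_lt_or_eq.1 hp with hlt | rfl
      · exact h₈.le.trans (hI₃ p hlt hps)
      · exact le_rfl
    · refine ⟨hI₁, fun h => ?_, fun p hp hps => ?_⟩
      · obtain ⟨h₆, h₇⟩ := hI₂ h
        exact ⟨by omega, h₇⟩
      · rcases Nat.lt_succ_iff_lt_or_eq.1 hp with hlt | rfl
        · exact hI₃ p hlt hps
        · exact hneg hps.le hps.ge
  · rintro m' hF ⟨hI₁, hI₂, hI₃⟩ p hp hps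
    have h₂ := hI₃ p hp hps
    have h₃ := maxVal_lt (c := q p) (K := σ) (Nat.add_one_pos N)
    obtain ⟨h₄, h₅, h₆⟩ := hI₂ (by omega)
    exact ⟨h₄, h₅, h₆ ▸ h₂⟩

/-! ### Extracting the path -/

/-- Follow the predecessors from the place in word register 6 and store in word array 7, for every
vertex, the successor of its last occurrence. -/
def traceProg : Program :=
  .loop (.le (.const 1) (.reg 6))
    (.seq (.seq (.setWord 7 (.arr 6 (.reg 6)))
      (.setWordArr 7 (.div (.arr 5 (.reg 6)) (.reg 5)) (.div (.arr 5 (.reg 7)) (.reg 5))))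
      (.setWord 6 (.reg 7)))

/-- The trace leads from the chosen state to place 0, and a later visit to a vertex overwrites its
pointer. So each pointer comes from an occurrence `i' ≥ i`, as `exists_isPath_of_steps` demands. -/
theorem runs_traceProg {W V τ b : ℕ} {q par : ℕ → ℕ} {m : Store} (hV : m.word 5 = V)
    (hq : m.wordArr 5 = q) (hpar : m.wordArr 6 = par) (hb : m.word 6 = b) (hbτ : b < τ)
    (hlt : ∀ p < τ, 0 < p → par p < p) (hqW : ∀ p < τ, q p ≤ W) (hτW : τ ≤ W) (hV' : V ≤ W) :
    Runs W traceProg m (100 * τ) (fun m' => ∃ L, par^[L] b = 0 ∧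
      (∀ i ≤ L, par^[i] b < τ) ∧ (∀ i < L, 0 < par^[i] b) ∧
      ∀ i < L, ∃ i', i ≤ i' ∧ i' < L ∧ q (par^[i'] b) / V = q (par^[i] b) / V ∧
        m'.wordArr 7 (q (par^[i] b) / V) = q (par^[i' + 1] b) / V) := by
  -- Predecessors lie strictly earlier in the queue; `par^[L] b + L ≤ b` records this and gives
  -- termination after at most `b` steps.
  refine (Runs.loop (fun L m' => m'.word 6 = par^[L] b ∧ par^[L] b + L ≤ b ∧
      (∀ i ≤ L, par^[i] b < τ) ∧ (∀ i < L, 0 < par^[i] b) ∧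
      ∀ i < L, ∃ i', i ≤ i' ∧ i' < L ∧ q (par^[i'] b) / V = q (par^[i] b) / V ∧
        m'.wordArr 7 (q (par^[i] b) / V) = q (par^[i' + 1] b) / V) b 20 ?_ ?_ ?_).mono
    (by simp only [Test.time, WExpr.time]; omega) ?_
  · refine ⟨hb, by simp, fun i hi => ?_, fun i hi => by omega, fun i hi => by omega⟩
    obtain rfl : i = 0 := by omega
    exact hbτ
  · rintro L m' hL hF ⟨h₁, -, h₂, -⟩
    have := h₂ L le_rfl
    simp only [Test.Fits, WExpr.Fits, h₁]
    omega
  · rintro L m' hL hF ⟨h₁, h₂, h₃, h₄, h₅⟩ hbt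
    have hpos : 0 < par^[L] b := by
      simpa [Test.Holds, WExpr.eval, h₁, Nat.one_le_iff_ne_zero, Nat.pos_iff_ne_zero] using hbt
    have hLτ := h₃ L le_rfl
    have hdec := hlt _ hLτ hpos
    have e : par (par^[L] b) = par^[L + 1] b := (Function.iterate_succ_apply' par L b).symm
    have hq₁ := hqW _ hLτ
    have hq₂ := hqW (par^[L + 1] b) (by omega)
    refine ⟨by omega, Runs.of_wp ?_ (by decide)⟩
    simp [Program.wp, WExpr.Fits, WExpr.eval, h₁, hF.word 5 rfl, hF.wordArr 5 rfl,
      hF.wordArr 6 rfl, hV, hq, hpar, e, -Function.iterate_succ, -Order.lt_add_one_iff]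
    refine ⟨by omega, by omega, by omega, by omega, by omega, fun i hi => ?_, fun i hi => ?_,
      fun i hi => ?_⟩
    · rcases hi.lt_or_eq with h | rfl
      · exact h₃ i (by omega)
      · omega
    · rcases Nat.lt_succ_iff_lt_or_eq.1 hi with h | rfl
      · exact h₄ i h
      · exact hpos
    -- If the vertex just written is that of position `i`, the newest occurrence `L` is the witness;
    -- otherwise the old pointer is untouched.
    · by_cases hv : q (par^[i] b) / V = q (par^[L] b) / V
      · refine ⟨L, by omega, by omega, hv.symm, ?_⟩
        rw [hv, Function.update_self]
      · have hiL : i < L := by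
          rcases Nat.lt_succ_iff_lt_or_eq.1 hi with h | rfl
          · exact h
          · exact absurd rfl hv
        obtain ⟨i', h₆, h₇, h₈, h₉⟩ := h₅ i hiL
        refine ⟨i', h₆, by omega, h₈, ?_⟩
        rw [Function.update_of_ne hv, h₉, Function.iterate_succ_apply]
  · rintro m' hF ⟨L, hL, ⟨h₁, h₂, h₃, h₄, h₅⟩, hbt⟩
    refine ⟨L, ?_, h₃, h₄, h₅⟩
    simp only [Test.Holds, WExpr.eval, h₁] at hbt
    omega

/-- Write the path to the output. -/
def outputProg : Program :=
  .seq (.seq (.setWord 7 (.reg 1)) (.setWord 8 (.const 0)))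
  (.seq (.loop (.not (.and (.le (.reg 7) (.reg 2)) (.le (.reg 2) (.reg 7))))
    (.seq (.setWordArr 0 (.reg 8) (.reg 7))
    (.seq (.setWord 7 (.arr 7 (.reg 7))) (.setWord 8 (.add (.reg 8) (.const 1))))))
  (.seq (.setWordArr 0 (.reg 8) (.reg 7)) (.setWord 0 (.reg 8))))

theorem runs_outputProg {W n : ℕ} {G : SimpleGraph (Fin n)} {s t : Fin n} {nxt : ℕ → ℕ}
    {m : Store} (hs : m.word 1 = s) (ht : m.word 2 = t) (hn : m.wordArr 7 = nxt)
    (P : G.Walk s t) (hP : P.IsPath)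
    (hnxt : ∀ k < P.length, nxt (P.getVert k) = P.getVert (k + 1)) (hW : n ≤ W) :
    Runs W outputProg m (100 * n) (fun m' => m'.word 0 = P.length ∧
      ∀ k ≤ P.length, m'.wordArr 0 k = P.getVert k) := by
  have hlen : P.length < n := by simpa using hP.length_lt
  refine (Runs.seq (R := fun m' => m'.word 7 = s ∧ m'.word 8 = 0) (t₁ := 4) (Runs.of_wp ?_
    (by decide)) fun m₁ hF₁ h₁ => ?_).mono
    (t₁ := 4 + ((P.length * (8 + 20 + 1) + (8 + 1)) + 6)) (by omega) fun _ _ h => h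
  · have := s.2
    simp [Program.wp, WExpr.Fits, WExpr.eval, hs]
    omega
  refine Runs.seq (R := fun m' => m'.word 7 = t ∧ m'.word 8 = P.length ∧
    ∀ k < P.length, m'.wordArr 0 k = P.getVert k) ((Runs.loop (fun k m' =>
      m'.word 7 = P.getVert k ∧ m'.word 8 = k ∧ ∀ k' < k, m'.wordArr 0 k' = P.getVert k')
      P.length 20 ?_ ?_ ?_).mono le_rfl ?_) fun m₂ hF₂ h₂ => ?_
  · simp [h₁]
  · rintro k m' hk hF ⟨h₂, -⟩
    have h₃ := (P.getVert k).2
    have h₄ := t.2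
    simp only [Test.Fits, WExpr.Fits, h₂, hF.word 2 rfl, hF₁.word 2 rfl, ht]
    omega
  · rintro k m' hk hF ⟨h₂, h₃, h₄⟩ hb
    have hkl : k < P.length := by
      rcases hk.lt_or_eq with h | rfl
      · exact h
      · rw [SimpleGraph.Walk.getVert_length] at h₂
        simp [Test.Holds, WExpr.eval, h₂, hF.word 2 rfl, hF₁.word 2 rfl, ht] at hb
    have h₅ := (P.getVert k).2
    have h₆ := (P.getVert (k + 1)).2
    refine ⟨hkl, Runs.of_wp ?_ (by decide)⟩
    simp [Program.wp, WExpr.Fits, WExpr.eval, h₂, h₃, hF.wordArr 7 rfl, hF₁.wordArr 7 rfl, hn,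
      hnxt k hkl, -Order.lt_add_one_iff]
    refine ⟨by omega, by omega, by omega, by omega, fun k' hk' => ?_⟩
    rcases Nat.lt_succ_iff_lt_or_eq.1 hk' with h | rfl
    · rw [Function.update_of_ne h.ne, h₄ k' h]
    · rw [Function.update_self]
  · rintro m' hF ⟨k, hk, ⟨h₂, h₃, h₄⟩, hb⟩
    have hkt : P.getVert k = t := by
      simp only [Test.Holds, WExpr.eval, h₂, hF.word 2 rfl, hF₁.word 2 rfl, ht, not_not] at hb
      exact Fin.ext (le_antisymm hb.1 hb.2)
    -- The loop stops on meeting `t`; since `P` is simple, this happens only at its end.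
    obtain rfl : k = P.length := hP.getVert_injOn hk (le_refl P.length)
      (hkt.trans P.getVert_length.symm)
    rw [hkt] at h₂
    exact ⟨h₂, h₃, h₄⟩
  · obtain ⟨h₃, h₄, h₅⟩ := h₂
    have := t.2
    refine Runs.of_wp ?_ (by decide)
    simp [Program.wp, WExpr.Fits, WExpr.eval, h₃, h₄]
    refine ⟨by omega, by omega, by omega, fun k hk => ?_⟩
    rcases hk.lt_or_eq with h | rfl
    · rw [Function.update_of_ne h.ne, h₅ k h]
    · rw [Function.update_self, SimpleGraph.Walk.getVert_length]

/-! # Correctness -/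

section

variable {n : ℕ} {G : SimpleGraph (Fin n)}

theorem weight_eq_sum_darts (w : ℕ → ℕ → ℝ) {v t : Fin n} (p : G.Walk v t) :
    weight w p = (p.darts.map fun e => w e.snd e.fst).sum := by
  induction p with
  | nil => rfl
  | cons h p ih => simp [ih]

theorem weight_bypass_le {w : ℕ → ℕ → ℝ} (hw : ∀ i j, 0 ≤ w i j) {v t : Fin n}
    (p : G.Walk v t) : weight w p.bypass ≤ weight w p := by
  rw [weight_eq_sum_darts, weight_eq_sum_darts]
  refine (p.darts_bypass_sublist_darts.map _).sum_le_sum fun x hx => ?_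
  obtain ⟨e, -, rfl⟩ := List.mem_map.1 hx
  exact hw _ _

end

theorem maxDist_nonneg (n σ : ℕ) (d : ℕ → ℝ) (i j y : ℕ) : 0 ≤ maxDist n σ d i j y := by
  induction y with
  | zero => exact le_rfl
  | succ y ih => exact ih.trans (le_max_left _ _)

namespace Instance

variable {M : Type*} [MetricSpace M] (I : Instance M)

/-- The weight of an edge is the largest distance between points of its ends. -/
noncomputable def maxWeight (i j : ℕ) : ℝ :=
  maxDist I.n I.sigma I.distArr i j (I.sigma * I.sigma)

theorem cost_le_weight {v t : Fin I.n} (P : I.G.Walk v t) : I.cost P ≤ weight I.maxWeight P := by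
  obtain ⟨u, hu, e⟩ := I.exists_walkSum_eq_cost P
  exact e ▸ walkSum_le_weight hu P

/-- The length `D` of a shortest path approximates the optimum within a factor of `n`. -/
theorem estimate {f : ℕ → ℕ} {b : ℕ → ℝ}
    (h : Relaxed I.G I.t I.maxWeight f b (I.n * I.n * I.n)) (hst : I.G.Reachable I.s I.t) :
    0 ≤ b I.s ∧ (∃ P : I.G.Walk I.s I.t, P.IsPath ∧ I.cost P ≤ b I.s) ∧
      ∀ P : I.G.Walk I.s I.t, P.IsPath → b I.s ≤ I.n * I.cost P := by
  obtain ⟨P₀⟩ := hst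
  have hlen : ∀ P : I.G.Walk I.s I.t, P.IsPath → P.length ≤ I.n := fun P hP => by
    simpa using hP.length_lt.le
  have hle : ∀ P : I.G.Walk I.s I.t, P.IsPath → f I.s ≠ 0 ∧ b I.s ≤ weight I.maxWeight P :=
    fun P hP => h.le_weight (r := I.n) (by rw [mul_assoc]) P (hlen P hP)
  -- The value at `s` belongs to some walk, perhaps not simple. Its bypass is a path of no larger
  -- weight.
  obtain ⟨P₁, e⟩ := h.sound I.s (hle _ P₀.bypass_isPath).1
  have h₁ : I.cost P₁.bypass ≤ b I.s := by
    rw [e]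
    exact (I.cost_le_weight _).trans
      (weight_bypass_le (fun i j => maxDist_nonneg _ _ _ i j _) P₁)
  refine ⟨(I.cost_nonneg _).trans h₁, ⟨_, P₁.bypass_isPath, h₁⟩, fun P hP => ?_⟩
  calc b I.s ≤ weight I.maxWeight P := (hle P hP).2
    _ ≤ P.length * I.cost P := weight_le_length_mul I.sigma_pos I.distArr_nonneg P
        fun u hu => I.walkSum_le_cost hu P
    _ ≤ I.n * I.cost P :=
        mul_le_mul_of_nonneg_right (by exact_mod_cast hlen P hP) (I.cost_nonneg P)

variable {N τ : ℕ} {D ε : ℝ} {R vis q par : ℕ → ℕ}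

/-- Every path of cost at most `D` is represented by a state that is found by the search. -/
theorem exists_mem_queue (hD : 0 ≤ D)
    (hR : ∀ p < I.n * I.sigma * (I.n * I.sigma), Rounded D N (I.distArr p) (R p))
    (hS : Search (I.n * (N + 1) ^ I.sigma) (I.t * (N + 1) ^ I.sigma)
      (IsStep I.n I.sigma (N + 1) I.adjArr R) vis q par τ)
    (hc : ∀ p < τ, ∀ c, IsStep I.n I.sigma (N + 1) I.adjArr R (q p) c → vis c ≠ 0)
    (Q : I.G.Walk I.s I.t) (hQ : Q.IsPath) (hQD : I.cost Q ≤ D) :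
    ∃ p < τ, q p / (N + 1) ^ I.sigma = I.s ∧ ∃ u : ℕ → ℕ, (∀ i, u i < I.sigma) ∧
      walkSum I.sigma R u Q = maxVal (N + 1) (q p) I.sigma := by
  -- The states in the queue form a set closed under steps: every successor is marked, and marked
  -- states are in the queue.
  obtain ⟨c, ⟨p, hp, rfl⟩, hcs, hval⟩ := exists_state_of_isPath (A := I.adjArr) (R := R)
    (B := N + 1) I.sigma_pos I.adjArr_ne_zero (Nat.add_one_pos N) (S := fun c => ∃ p < τ, q p = c)
    ⟨0, hS.pos, hS.first⟩
    (by
      rintro c c' ⟨p, hp, rfl⟩ hs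
      exact hS.exists_of_vis c' (hc p hp c' hs)) Q hQ
    (fun u hu => Nat.lt_succ_iff.2 (walkSum_le_of_le hD I.distArr_nonneg hR hu Q
      ((I.walkSum_le_cost hu Q).trans hQD)))
  obtain ⟨k, hk, e⟩ := exists_maxVal_eq (B := N + 1) (c := q p) I.sigma_pos
  obtain ⟨u, hu, -, e'⟩ := hval k hk
  exact ⟨p, hp, hcs, u, hu, e'.trans e.symm⟩

/-- A path that is represented by the best state found is a good approximation. -/
theorem isApprox_of_best (hD : 0 ≤ D) (hN : 0 < N) (hε : 0 < ε) (hNε : (I.n : ℝ) * I.n ≤ N * ε)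
    (hR : ∀ p < I.n * I.sigma * (I.n * I.sigma), Rounded D N (I.distArr p) (R p))
    (hS : Search (I.n * (N + 1) ^ I.sigma) (I.t * (N + 1) ^ I.sigma)
      (IsStep I.n I.sigma (N + 1) I.adjArr R) vis q par τ)
    (hc : ∀ p < τ, ∀ c, IsStep I.n I.sigma (N + 1) I.adjArr R (q p) c → vis c ≠ 0)
    (hD₁ : ∃ P : I.G.Walk I.s I.t, P.IsPath ∧ I.cost P ≤ D)
    (hD₂ : ∀ P : I.G.Walk I.s I.t, P.IsPath → D ≤ I.n * I.cost P) {b : ℕ}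
    (hb : ∀ p < τ, q p / (N + 1) ^ I.sigma = I.s →
      maxVal (N + 1) (q b) I.sigma ≤ maxVal (N + 1) (q p) I.sigma)
    {P : I.G.Walk I.s I.t} (hP : P.IsPath)
    (hPu : ∀ u : ℕ → ℕ, (∀ i, u i < I.sigma) →
      walkSum I.sigma R u P ≤ q b / (N + 1) ^ u I.s % (N + 1)) :
    I.IsApprox (1 + ε) P := by
  have main : ∀ Q : I.G.Walk I.s I.t, Q.IsPath → I.cost Q ≤ D →
      I.cost P ≤ (1 + ε) * I.cost Q := fun Q hQ hQD => by
    obtain ⟨p, hp, hps, u', hu', e'⟩ := I.exists_mem_queue hD hR hS hc Q hQ hQD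
    obtain ⟨u, hu, e⟩ := I.exists_walkSum_eq_cost P
    rw [← e]
    have h₁ := hPu u hu
    have h₂ : q b / (N + 1) ^ u I.s % (N + 1) < N + 1 := Nat.mod_lt _ (Nat.add_one_pos N)
    have h₃ : q b / (N + 1) ^ u I.s % (N + 1) ≤ maxVal (N + 1) (q b) I.sigma :=
      le_maxVal (hu _)
    have h₄ := hb p hp hps
    exact walkSum_le_mul_of_rounded hD hN hNε hR hP hu hu' (by omega) (by omega)
      (I.cost_nonneg Q) (I.walkSum_le_cost hu' Q) (hD₂ Q hQ)
  refine ⟨hP, fun Q hQ => ?_⟩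
  -- A path costing more than `D` may have no state at all. It is beaten through a path of cost at
  -- most `D`.
  by_cases hQD : I.cost Q ≤ D
  · exact main Q hQ hQD
  · obtain ⟨P₀, hP₀, hle⟩ := hD₁
    exact (main P₀ hP₀ hle).trans (mul_le_mul_of_nonneg_left (hle.trans (not_le.1 hQD).le)
      (by linarith))

end Instance

/-! ### Assembling the scheme -/

/-- The approximation scheme. -/
def schemeProg : Program :=
  .seq levelsProg (.seq shortestProg (.seq roundProg (.seq powProg (.seq searchProg
    (.seq bestProg (.seq traceProg outputProg))))))

theorem runs_schemeProg {M : Type*} [MetricSpace M] (I : Instance M) {ε : ℝ} {N K W : ℕ}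
    (hst : I.G.Reachable I.s I.t) (hε : 0 < ε) (hN : 0 < N)
    (hNε : (I.n : ℝ) * I.n ≤ N * ε)
    (hlt : ∀ k : ℕ, 0 < k → k < N → k * ε < (I.n : ℝ) * I.n)
    (hK : K = I.n * I.n * I.n * (I.sigma * I.sigma) * (N + 1) ^ I.sigma) (hW : 2 * K ≤ W) :
    Runs W schemeProg (I.input ε) (2000 * K) (fun m => ∃ P : I.G.Walk I.s I.t,
      I.IsOutput m P ∧ I.IsApprox (1 + ε) P) := by
  set n := I.n with hn
  set σ := I.sigma with hσ
  set V := (N + 1) ^ σ with hV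
  have hn0 : 0 < n := I.n_pos
  have hσ0 : 0 < σ := I.sigma_pos
  have hNV : N + 1 ≤ V := Nat.le_self_pow hσ0.ne' _
  have hV0 : 0 < V := by omega
  -- The bounds `k₁` to `k₁₁` show that `K` dominates the running times of all stages, up to
  -- constants, and the words they use.
  have k₁ : n * n * n * (σ * σ) ≤ K := hK ▸ Nat.le_mul_of_pos_right _ hV0
  have k₂ : n * n * n ≤ K := (Nat.le_mul_of_pos_right _ (Nat.mul_pos hσ0 hσ0)).trans k₁
  have k₃ : n * n ≤ K := (Nat.le_mul_of_pos_right _ hn0).trans k₂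
  have k₄ : n * V * (n * (σ * σ)) ≤ K := by
    rw [hK]
    calc n * V * (n * (σ * σ)) = 1 * (n * n * (σ * σ) * V) := by ring
      _ ≤ n * (n * n * (σ * σ) * V) := Nat.mul_le_mul_right _ hn0
      _ = _ := by ring
  have k₅ : n * V ≤ K :=
    (Nat.le_mul_of_pos_right _ (Nat.mul_pos hn0 (Nat.mul_pos hσ0 hσ0))).trans k₄
  have k₆ : V ≤ K := (Nat.le_mul_of_pos_left _ hn0).trans k₅
  have k₇ : n * σ * (n * σ) * (N + 1) ≤ K := by
    calc n * σ * (n * σ) * (N + 1) ≤ n * σ * (n * σ) * V := Nat.mul_le_mul_left _ hNV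
      _ = n * V * (n * (σ * σ)) := by ring
      _ ≤ K := k₄
  have k₈ : n * σ * (n * σ) ≤ K := (Nat.le_mul_of_pos_right _ (Nat.add_one_pos N)).trans k₇
  have k₉ : n * V * σ ≤ K := by
    refine le_trans (Nat.mul_le_mul_left _ ?_) k₄
    exact (Nat.le_mul_self σ).trans (Nat.le_mul_of_pos_left _ hn0)
  have k₁₀ : σ ≤ K := (Nat.le_mul_of_pos_left _ (Nat.mul_pos hn0 hV0)).trans k₉
  have k₁₁ : n ≤ K := (Nat.le_mul_self n).trans k₃
  have hA1 := I.adjArr_le_one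
  have hA := I.adjArr_ne_zero
  have kW : K ≤ W := by omega
  have hMW : n * V ≤ W := k₅.trans kW
  have hVW : V ≤ W := k₆.trans kW
  have hNW : 2 * (N + 1) ≤ W := by omega
  set m := I.input ε with hm
  refine (Runs.seq (runs_levelsProg (W := W) (K := K) (n := n) (N := N) (ε := ε) (m := m) rfl rfl
    hN hNε hlt k₃ (by omega) kW hn0) fun m₁ F₁ h₁ => ?_).mono
    (t₁ := 100 * K + (400 * K + ((200 * K + 20) + (20 * (σ + 1) + (600 * (n * V * (n * (σ * σ))) +
      ((200 * K + 20) + (100 * K + 100 * K))))))) (by omega) fun _ _ h => h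
  refine Runs.seq (runs_shortestProg (G := I.G) (A := I.adjArr) (d := I.distArr) (σ := σ) (s := I.s)
    (t := I.t) (K := K) (F₁.word 0 rfl) (F₁.word 1 rfl) (F₁.word 2 rfl) (F₁.word 3 rfl)
    (F₁.wordArr 0 rfl) (F₁.realArr 0 rfl) hA hA1 (F₁.wordArr 2 rfl) (F₁.realArr 1 rfl)
    (k₈.trans kW) (k₂.trans kW) hσ0 k₁) fun m₂ F₂ ⟨f, b, hb, h₂⟩ => ?_
  obtain ⟨hD, hD₁, hD₂⟩ := I.estimate hb hst
  set D := b I.s with hDdef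
  refine Runs.seq (runs_roundProg (n := n) (σ := σ) (N := N) (D := D) (d := I.distArr) (K := K)
    ((F₂.word 0 rfl).trans (F₁.word 0 rfl)) ((F₂.word 3 rfl).trans (F₁.word 3 rfl))
    ((F₂.word 4 rfl).trans h₁) h₂ ((F₂.realArr 0 rfl).trans (F₁.realArr 0 rfl))
    I.distArr_nonneg hD (k₈.trans kW) (by omega) hn0 hσ0 k₇) fun m₃ F₃ h₃ => ?_
  refine Runs.seq (runs_powProg (σ := σ) (N := N)
    ((F₃.word 3 rfl).trans ((F₂.word 3 rfl).trans (F₁.word 3 rfl)))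
    ((F₃.word 4 rfl).trans ((F₂.word 4 rfl).trans h₁)) hVW (hNV.trans hVW) (k₁₀.trans kW))
    fun m₄ F₄ h₄ => ?_
  have F : ∀ y, y < 4 → m₄.word y = m.word y := fun y hy => by
    interval_cases y <;> rw [F₄.word _ rfl, F₃.word _ rfl, F₂.word _ rfl, F₁.word _ rfl]
  have e4 : m₄.word 4 = N := by rw [F₄.word 4 rfl, F₃.word 4 rfl, F₂.word 4 rfl, h₁]
  have FA : m₄.wordArr 0 = m.wordArr 0 := by
    rw [F₄.wordArr _ rfl, F₃.wordArr _ rfl, F₂.wordArr _ rfl, F₁.wordArr _ rfl]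
  have Fvis : m₄.wordArr 4 = m.wordArr 4 := by
    rw [F₄.wordArr _ rfl, F₃.wordArr _ rfl, F₂.wordArr _ rfl, F₁.wordArr _ rfl]
  set R := m₃.wordArr 3 with hRdef
  refine Runs.seq (runs_searchProg (n := n) (t := I.t) (σ := σ) (N := N) (A := I.adjArr) (R := R)
    (F 0 (by omega)) (F 2 (by omega)) (F 3 (by omega)) e4 h₄ FA (F₄.wordArr 3 rfl) Fvis hA1
    (fun p hp => (h₃ p hp).le) hσ0 (k₃.trans kW) hMW hNW (k₈.trans kW))
    fun m₅ F₅ ⟨hS, hc⟩ => ?_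
  have hτ := hS.le
  have hqW : ∀ p < m₅.word 9, m₅.wordArr 5 p ≤ W := fun p hp => by
    exact (hS.lt p hp).le.trans hMW
  have e4' : m₅.word 4 = N := (F₅.word 4 rfl).trans e4
  have e5' : m₅.word 5 = V := (F₅.word 5 rfl).trans h₄
  have hτK : m₅.word 9 * σ ≤ K := (Nat.mul_le_mul_right _ hτ).trans k₉
  have hs := I.s.2
  refine Runs.seq ((runs_bestProg (s := I.s) (σ := σ) (N := N) (V := V)
    ((F₅.word 1 rfl).trans (F 1 (by omega))) ((F₅.word 3 rfl).trans (F 3 (by omega))) e4' e5'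
    rfl rfl hσ0 (k₁₀.trans kW) hqW (hτ.trans hMW) hVW hVW (hs.le.trans (k₁₁.trans kW)) hNW).mono
    (by omega) fun _ _ h => h) fun m₆ F₆ h₆ => ?_
  obtain ⟨P₀, hP₀, hP₀D⟩ := hD₁
  obtain ⟨p₀, hp₀, hp₀s, -⟩ := I.exists_mem_queue hD h₃ hS hc P₀ hP₀ hP₀D
  obtain ⟨hbτ, hbs, -⟩ := h₆ p₀ hp₀ hp₀s
  set τ := m₅.word 9 with hτdef
  set q := m₅.wordArr 5 with hq
  set par := m₅.wordArr 6 with hpar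
  refine Runs.seq ((runs_traceProg (V := V) (τ := τ) (q := q) (par := par) (b := m₆.word 6)
    ((F₆.word 5 rfl).trans e5') (F₆.wordArr 5 rfl) (F₆.wordArr 6 rfl) rfl hbτ
    (fun p hp hp' => (hS.step p hp hp').1) hqW (hτ.trans hMW) hVW).mono
    (Nat.mul_le_mul_left _ (hτ.trans k₅)) fun _ _ h => h) fun m₇ F₇ ⟨L, hL₀, hLτ, hLpos, hnxt⟩ => ?_
  have F' : ∀ y, 0 < y → y < 3 → m₇.word y = m.word y := fun y hy hy' => by
    interval_cases y <;> rw [F₇.word _ rfl, F₆.word _ rfl, F₅.word _ rfl, F _ (by omega)]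
  -- The chain of predecessors is a walk in the graph of states from the best state at `s` to the
  -- initial state at `t`.
  obtain ⟨P, hP, hPn, hPu⟩ := exists_isPath_of_steps (n := n) (σ := σ) (B := N + 1)
    (A := I.adjArr) (R := R) hA (t := I.t) (Q := fun i => q (par^[i] (m₆.word 6))) (L := L)
    (nxt := m₇.wordArr 7)
    (fun i hi => by
      have := (hS.step _ (hLτ i hi.le) (hLpos i hi)).2
      rwa [← Function.iterate_succ_apply' par i] at this)
    (by
      simp only [hL₀, hS.first]
      exact Nat.mul_div_cancel _ hV0)
    hnxt (v := I.s) hbs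
  refine (runs_outputProg (n := n) (G := I.G) (s := I.s) (t := I.t) (F' 1 (by omega) (by omega))
    (F' 2 (by omega) (by omega)) rfl P hP hPn (k₁₁.trans kW)).mono
    (Nat.mul_le_mul_left _ k₁₁) fun m₈ _ h₈ => ?_
  exact ⟨P, h₈, I.isApprox_of_best hD hN hε hNε h₃ hS hc ⟨P₀, hP₀, hP₀D⟩ hD₂
    (fun p hp hps => (h₆ p hp hps).2.2) hP hPu⟩

/-- The number of rounding levels. -/
theorem exists_levels {n : ℕ} {ε : ℝ} (hε : 0 < ε) :
    ∃ N : ℕ, 0 < N ∧ (n : ℝ) * n ≤ N * ε ∧ (∀ k : ℕ, 0 < k → k < N → k * ε < (n : ℝ) * n) ∧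
      (N : ℝ) + 1 ≤ 3 * max 1 ((n : ℝ) ^ 2 / ε) := by
  have h₁ := le_max_left 1 ((n : ℝ) ^ 2 / ε)
  have h₂ := le_max_right 1 ((n : ℝ) ^ 2 / ε)
  have h₀ : (0 : ℝ) ≤ (n : ℝ) ^ 2 / ε := by positivity
  -- The ceiling exceeds `n² / ε` by at most 1, so `N + 1 ≤ max(1, n² / ε) + 2 ≤ 3 max(1, n² / ε)`.
  -- The maximum with 1 covers `n = 0`.
  refine ⟨max 1 ⌈(n : ℝ) ^ 2 / ε⌉₊, by simp, ?_, fun k hk hkN => ?_, ?_⟩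
  · rw [← sq, ← div_le_iff₀ hε]
    exact (Nat.le_ceil _).trans (by exact_mod_cast le_max_right _ _)
  · rcases lt_max_iff.1 hkN with h | h
    · omega
    · rw [← sq, ← lt_div_iff₀ hε]
      exact Nat.lt_ceil.1 h
  · have h₃ := (Nat.ceil_lt_add_one h₀).le
    rw [Nat.cast_max, Nat.cast_one]
    have : max 1 (⌈(n : ℝ) ^ 2 / ε⌉₊ : ℝ) ≤ max 1 ((n : ℝ) ^ 2 / ε) + 1 :=
      max_le (by linarith) (by linarith)
    linarith

end RobustSP

theorem mainTheorem1 :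
    ∃ A : RobustSP.Program, ∀ σ : ℕ, ∃ C : ℝ,
      ∀ (M : Type*) [MetricSpace M] (I : RobustSP.Instance M) (ε : ℝ),
        I.sigma = σ → I.G.Reachable I.s I.t → 0 < ε →
          ∃ (T : ℕ) (m : RobustSP.Store) (P : I.G.Walk I.s I.t),
            RobustSP.Exec ⌊C * I.bound ε⌋₊ A (I.input ε) T m ∧
            (T : ℝ) ≤ C * I.bound ε ∧
            I.IsOutput m P ∧
            I.IsApprox (1 + ε) P := by
  -- The factor 2000 is that of `runs_schemeProg`; `3 ^ σ` comes from raising `N + 1 ≤ 3 max(1, n² /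
  -- ε)` to the power `σ`.
  refine ⟨RobustSP.schemeProg, fun σ => ⟨2000 * 3 ^ σ, fun M _ I ε hσ hst hε => ?_⟩⟩
  obtain ⟨N, hN, hNε, hlt, hN3⟩ := RobustSP.exists_levels (n := I.n) hε
  have hK : ((2000 * (I.n * I.n * I.n * (I.sigma * I.sigma) * (N + 1) ^ I.sigma) : ℕ) : ℝ) ≤
      2000 * 3 ^ σ * I.bound ε := by
    have h₁ : ((N : ℝ) + 1) ^ I.sigma ≤ (3 * max 1 ((I.n : ℝ) ^ 2 / ε)) ^ I.sigma :=
      pow_le_pow_left₀ (by positivity) hN3 _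
    have h₂ : (0 : ℝ) ≤ 2000 * ((I.n : ℝ) ^ 3 * (I.sigma : ℝ) ^ 2) := by positivity
    have h₃ := mul_le_mul_of_nonneg_left h₁ h₂
    rw [mul_pow] at h₃
    rw [RobustSP.Instance.bound, ← hσ]
    push_cast
    linarith
  obtain ⟨T, m, hexec, hT, P, hout, happ⟩ := RobustSP.runs_schemeProg I hst hε hN hNε hlt rfl
    (W := ⌊2000 * 3 ^ σ * I.bound ε⌋₊) (le_trans (by omega) (Nat.le_floor hK))
  exact ⟨T, m, P, hexec, (Nat.cast_le.2 hT).trans hK, hout, happ⟩
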